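/- Let $X=\mathbb P^1(\mathbb C)$, let $\mathcal E$ be (the sheaf of holomorphic sections of) a holomorphic vector bundle of rank $n$ on $X$, let $x\in X$, let $\mathcal O_x$ be the ring of germs at $x$ of holomorphic functions, $K_x$ its fraction field, and $V_x=\mathcal E_x\otimes_{\mathcal O_x}K_x$. A lattice in $V_x$ is an $\mathcal O_x$-submodule spanned by a $K_x$-basis of $V_x$. For a lattice $M$, let $\mathcal E^M$ be the bundle that coincides with $\mathcal E$ on $X\setminus\{x\}$ and has stalk $M$ at $x$; $M$ is called trivialising for $\mathcal E$ at $x$ if $\mathcal E^M\simeq\mathcal O(m)^{n}$ for some $m\in\mathbb Z$ (with $m=0$ if $\mathcal E^M$ is trivial). Let $z$ be a local coordinate centred at $x$. The elementary divisors $k=(k_1\le\dots\le k_n)$ of $\mathcal E_x$ in $M$ are the integers for which there is an $\mathcal O_x$-basis $(e_1,\dots,e_n)$ of $M$ such that $(z^{k_1}e_1,\dots,z^{k_n}e_n)$ is an $\mathcal O_x$-basis of $\mathcal E_x$. Put $T=k-\min_i k_i$ and $d=\max_i k_i-\min_i k_i$; the elementary splitting of $T$ is $T=T_1+\dots+T_d$,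 where $T_j=(\min(T_i,j)-\min(T_i,j-1))_{1\le i\le n}$ and $T_i$ on the right denotes the $i$-th entry of $T$. Let $M$ be any trivialising lattice of $\mathcal E$ at $x$, with $\mathcal E^M\simeq\mathcal O(m)^n$, let $k$ be the elementary divisors of $\mathcal E_x$ in $M$, and let $T_1+\dots+T_d$ be the elementary splitting of $T=k-\min_i k_i$. Then $\mathcal E$ has a unique type, that is, there is a unique sequence $a_1\ge\dots\ge a_n$ of integers with $\mathcal E\simeq\mathcal O(a_1)\oplus\dots\oplus\mathcal O(a_n)$, and there are permutations $w_2,\dots,w_d\in S_n$, acting on sequences by permuting their entries, such that, up to permutation of the entries, $$(a_1,\dots,a_n)=\bigl(m-\min_i k_i\bigr)(1,\dots,1)-\bigl(T_1+w_2(T_2)+\dots+w_d(T_d)\bigr).$$ -/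

import Mathlib

open Bundle TopologicalSpace
open scoped Manifold ContDiff Topology

noncomputable section

/-- The Riemann sphere `ℙ¹(ℂ) = ℂ ∪ {∞}`. -/
abbrev RiemannSphere : Type := OnePoint ℂ

namespace RiemannSphere

def inversion : RiemannSphere → RiemannSphere :=
  fun p => p.elim ((0 : ℂ) : RiemannSphere) (fun z => if z = 0 then OnePoint.infty else ((z⁻¹ : ℂ) : RiemannSphere))

theorem inversion_infty : inversion OnePoint.infty = ((0 : ℂ) : RiemannSphere) := rfl
theorem inversion_zero : inversion ((0 : ℂ) : RiemannSphere) = OnePoint.infty := by simp [inversion]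
theorem inversion_coe {z : ℂ} (hz : z ≠ 0) :
    inversion (z : RiemannSphere) = ((z⁻¹ : ℂ) : RiemannSphere) := by simp [inversion, hz]

theorem inversion_inversion (p : RiemannSphere) : inversion (inversion p) = p := by
  induction p using OnePoint.rec with
  | infty => rw [inversion_infty, inversion_zero]
  | coe z =>
    by_cases hz : z = 0
    · subst hz; rw [inversion_zero, inversion_infty]
    · rw [inversion_coe hz, inversion_coe (inv_ne_zero hz), inv_inv]

theorem continuous_inversion : Continuous inversion := by
  have hc : Filter.coclosedCompact ℂ = Bornology.cobounded ℂ := by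
    rw [Filter.coclosedCompact_eq_cocompact, Metric.cobounded_eq_cocompact]
  rw [continuous_iff_continuousAt]
  intro p
  induction p using OnePoint.rec with
  | infty =>
    rw [OnePoint.continuousAt_infty', inversion_infty, hc]
    have h0 : Filter.Tendsto (fun z : ℂ => ((z⁻¹ : ℂ) : RiemannSphere)) (Bornology.cobounded ℂ)
        (𝓝 ((0 : ℂ) : RiemannSphere)) :=
      (OnePoint.continuous_coe.tendsto 0).comp Filter.tendsto_inv₀_cobounded
    refine h0.congr' ?_
    filter_upwards [Bornology.eventually_ne_cobounded (0 : ℂ)] with z hz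
    simp [inversion_coe hz]
  | coe z =>
    rw [OnePoint.continuousAt_coe]
    by_cases hz : z = 0
    · subst hz
      rw [continuousAt_iff_punctured_nhds]
      simp only [Function.comp_apply, inversion_zero]
      have h0 : Filter.Tendsto (fun z : ℂ => ((z⁻¹ : ℂ) : RiemannSphere)) (𝓝[≠] 0)
          (𝓝 (OnePoint.infty : RiemannSphere)) := by
        refine OnePoint.tendsto_coe_infty.comp ?_
        rw [hc]
        exact Filter.tendsto_inv₀_nhdsNE_zero
      refine h0.congr' ?_
      filter_upwards [self_mem_nhdsWithin] with w hw
      simp [inversion_coe (show w ≠ 0 from hw)]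
    · have h0 : ContinuousAt (fun z : ℂ => ((z⁻¹ : ℂ) : RiemannSphere)) z :=
        OnePoint.continuous_coe.continuousAt.comp (continuousAt_inv₀ hz)
      refine h0.congr ?_
      filter_upwards [isOpen_ne.mem_nhds hz] with w hw
      simp [inversion_coe hw]

def inversionHomeomorph : RiemannSphere ≃ₜ RiemannSphere where
  toFun := inversion
  invFun := inversion
  left_inv := inversion_inversion
  right_inv := inversion_inversion
  continuous_toFun := continuous_inversion
  continuous_invFun := continuous_inversion

/-- The chart `z ↦ z` on `ℂ`. -/
def affineChart : OpenPartialHomeomorph (RiemannSphere) ℂ :=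
  (OnePoint.isOpenEmbedding_coe.toOpenPartialHomeomorph ((↑) : ℂ → RiemannSphere)).symm

/-- The chart `z ↦ 1 / z`, `∞ ↦ 0` on the complement of `0`. -/
def inftyChart : OpenPartialHomeomorph (RiemannSphere) ℂ :=
  inversionHomeomorph.toOpenPartialHomeomorph.trans affineChart

theorem affineChart_coe (z : ℂ) : affineChart (z : RiemannSphere) = z :=
  OnePoint.isOpenEmbedding_coe.toOpenPartialHomeomorph_left_inv ((↑) : ℂ → RiemannSphere)
theorem affineChart_symm (z : ℂ) : affineChart.symm z = (z : RiemannSphere) := rfl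
theorem affineChart_source : affineChart.source = Set.range ((↑) : ℂ → RiemannSphere) := by
  simp [affineChart]
theorem affineChart_target : affineChart.target = Set.univ := by
  simp [affineChart]
theorem inftyChart_infty : inftyChart OnePoint.infty = 0 := affineChart_coe 0
theorem inftyChart_coe (z : ℂ) (hz : z ≠ 0) : inftyChart (z : RiemannSphere) = z⁻¹ := by
  change affineChart (inversion z) = _
  rw [inversion_coe hz, affineChart_coe]
theorem inftyChart_symm (z : ℂ) : inftyChart.symm z = inversion (z : RiemannSphere) := rfl

theorem mem_inftyChart_source {p : RiemannSphere} :
    p ∈ inftyChart.source ↔ p ≠ ((0 : ℂ) : RiemannSphere) := by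
  have : p ∈ inftyChart.source ↔ inversion p ∈ affineChart.source := by
    simp [inftyChart, inversionHomeomorph]
  rw [this, affineChart_source]
  induction p using OnePoint.rec with
  | infty => simp [inversion_infty]
  | coe z =>
    by_cases hz : z = 0
    · subst hz; simp [inversion_zero]
    · simp [inversion_coe hz, hz]

instance : ChartedSpace ℂ (RiemannSphere) where
  atlas := {affineChart, inftyChart}
  chartAt p := p.elim inftyChart (fun _ => affineChart)
  mem_chart_source p := by
    induction p using OnePoint.rec with
    | infty => exact mem_inftyChart_source.2 (OnePoint.infty_ne_coe 0)
    | coe z => exact affineChart_source ▸ Set.mem_range_self z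
  chart_mem_atlas p := by
    induction p using OnePoint.rec with
    | infty => exact Or.inr rfl
    | coe z => exact Or.inl rfl

instance : IsManifold 𝓘(ℂ) ω RiemannSphere := by
  have key : ContDiffOn ℂ ω (fun z : ℂ => z⁻¹) {z | z ≠ 0} :=
    fun z hz => (contDiffAt_inv ℂ hz).contDiffWithinAt
  refine isManifold_of_contDiffOn _ _ _ ?_
  rintro e e' (rfl | rfl) (rfl | rfl)
  · refine contDiffOn_id.congr fun z _ => ?_
    simp [affineChart_symm, affineChart_coe]
  · have hs : ∀ z ∈ (affineChart.symm.trans inftyChart).source, z ≠ 0 := by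
      rintro z hz rfl
      exact mem_inftyChart_source.1 hz.2 rfl
    refine (key.mono (fun z hz => hs z hz.1)).congr fun z hz => ?_
    exact inftyChart_coe z (hs z hz.1)
  · have hs : ∀ z ∈ (inftyChart.symm.trans affineChart).source, z ≠ 0 := by
      rintro z hz rfl
      have h2 : inversion ((0 : ℂ) : RiemannSphere) ∈ affineChart.source := hz.2
      rw [inversion_zero, affineChart_source] at h2
      simp at h2
    refine (key.mono (fun z hz => hs z hz.1)).congr fun z hz => ?_
    change affineChart (inversion z) = z⁻¹
    rw [inversion_coe (hs z hz.1), affineChart_coe]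
  · refine contDiffOn_id.congr fun z hz => ?_
    exact inftyChart.right_inv hz.1.1

end RiemannSphere

open RiemannSphere

/-- A function on the Riemann sphere is holomorphic at (hence near) `p`. -/
def HolAt (f : RiemannSphere → ℂ) (p : RiemannSphere) : Prop :=
  ContMDiffAt 𝓘(ℂ) 𝓘(ℂ) ω f p

/-- The punctured germs at `x` of complex functions. -/
abbrev FunGerm (x : RiemannSphere) : Type := Filter.Germ (𝓝[≠] x) ℂ

/-- The local ring of germs of holomorphic functions at `x`. A germ of a holomorphic function is
determined by its restriction to punctured neighbourhoods. -/
def holGerm (x : RiemannSphere) : Subring (FunGerm x) where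
  carrier := {φ | ∃ f : RiemannSphere → ℂ, HolAt f x ∧ φ = (f : FunGerm x)}
  mul_mem' := by
    rintro _ _ ⟨f, hf, rfl⟩ ⟨g, hg, rfl⟩
    exact ⟨f * g, ContMDiffAt.mul hf hg, rfl⟩
  one_mem' := ⟨1, contMDiffAt_const, rfl⟩
  add_mem' := by
    rintro _ _ ⟨f, hf, rfl⟩ ⟨g, hg, rfl⟩
    exact ⟨f + g, ContMDiffAt.add hf hg, rfl⟩
  zero_mem' := ⟨0, contMDiffAt_const, rfl⟩
  neg_mem' := by
    rintro _ ⟨f, hf, rfl⟩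
    exact ⟨-f, ContMDiffAt.neg hf, rfl⟩

/-- The field of germs of meromorphic functions at `x`. -/
def merGerm (x : RiemannSphere) : Subring (FunGerm x) where
  carrier := {φ | ∃ f : RiemannSphere → ℂ,
    MeromorphicAt (f ∘ (chartAt ℂ x).symm) (chartAt ℂ x x) ∧ φ = (f : FunGerm x)}
  mul_mem' := by
    rintro _ _ ⟨f, hf, rfl⟩ ⟨g, hg, rfl⟩
    exact ⟨f * g, hf.mul hg, rfl⟩
  one_mem' := ⟨1, MeromorphicAt.const 1 _, rfl⟩
  add_mem' := by
    rintro _ _ ⟨f, hf, rfl⟩ ⟨g, hg, rfl⟩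
    exact ⟨f + g, hf.add hg, rfl⟩
  zero_mem' := ⟨0, MeromorphicAt.const 0 _, rfl⟩
  neg_mem' := by
    rintro _ ⟨f, hf, rfl⟩
    exact ⟨-f, hf.neg, rfl⟩

/-- The germ at `x` of `z ^ k`, where `z` is the local coordinate centred at `x` given by the
chart at `x`. -/
def coordPow (x : RiemannSphere) (k : ℤ) : FunGerm x :=
  ((fun q => (chartAt ℂ x q - chartAt ℂ x x) ^ k : RiemannSphere → ℂ) : FunGerm x)

section Germs

variable (W : RiemannSphere → Type*) [∀ p, AddCommGroup (W p)] [∀ p, Module ℂ (W p)]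

/-- The (discontinuous) sections of `W` that vanish on some punctured neighbourhood of `x`. -/
def eventuallyZero (x : RiemannSphere) : Submodule ℂ (∀ p, W p) where
  carrier := {s | ∀ᶠ p in 𝓝[≠] x, s p = 0}
  add_mem' := by
    intro s t (hs : ∀ᶠ p in 𝓝[≠] x, s p = 0) (ht : ∀ᶠ p in 𝓝[≠] x, t p = 0)
    change ∀ᶠ p in 𝓝[≠] x, s p + t p = 0
    filter_upwards [hs, ht] with p h1 h2
    rw [h1, h2, add_zero]
  zero_mem' := by
    change ∀ᶠ p in 𝓝[≠] x, (0 : W p) = 0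
    exact Filter.Eventually.of_forall fun _ => rfl
  smul_mem' := by
    intro c s (hs : ∀ᶠ p in 𝓝[≠] x, s p = 0)
    change ∀ᶠ p in 𝓝[≠] x, c • s p = 0
    filter_upwards [hs] with p h1
    rw [h1, smul_zero]

/-- The punctured germs at `x` of arbitrary sections of `W`. -/
abbrev SecGerm (x : RiemannSphere) := (∀ p, W p) ⧸ eventuallyZero W x

variable {W}

/-- The punctured germ at `x` of a section. -/
def secGerm (x : RiemannSphere) (s : ∀ p, W p) : SecGerm W x := Submodule.Quotient.mk s

theorem secGerm_eq_iff {x : RiemannSphere} {s t : ∀ p, W p} :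
    secGerm x s = secGerm x t ↔ ∀ᶠ p in 𝓝[≠] x, s p = t p := by
  rw [secGerm, secGerm, Submodule.Quotient.eq]
  change (∀ᶠ p in 𝓝[≠] x, s p - t p = 0) ↔ _
  simp only [sub_eq_zero]

/-- Germs of functions act on germs of sections by pointwise multiplication. -/
instance germSMul (x : RiemannSphere) : SMul (FunGerm x) (SecGerm W x) where
  smul φ g := Quotient.liftOn₂ φ g (fun f s => secGerm x fun p => f p • s p) (by
    intro f s f' s' hf hs
    have hs' : ∀ᶠ p in 𝓝[≠] x, s p = s' p := secGerm_eq_iff.1 (Quotient.sound hs)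
    have hf' : ∀ᶠ p in 𝓝[≠] x, f p = f' p := hf
    refine secGerm_eq_iff.2 ?_
    filter_upwards [hs', hf'] with p h1 h2
    rw [h1, h2])

theorem coe_smul_secGerm {x : RiemannSphere} (f : RiemannSphere → ℂ) (s : ∀ p, W p) :
    (f : FunGerm x) • secGerm x s = secGerm x fun p => f p • s p := rfl

instance germModule (x : RiemannSphere) : Module (FunGerm x) (SecGerm W x) where
  one_smul := by
    rintro ⟨s⟩
    exact congrArg (secGerm x) (funext fun p => one_smul ℂ (s p))
  mul_smul := by
    rintro ⟨f⟩ ⟨g⟩ ⟨s⟩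
    exact congrArg (secGerm x) (funext fun p => mul_smul (f p) (g p) (s p))
  smul_zero := by
    rintro ⟨f⟩
    exact congrArg (secGerm x) (funext fun p => smul_zero (f p))
  smul_add := by
    rintro ⟨f⟩ ⟨s⟩ ⟨t⟩
    exact congrArg (secGerm x) (funext fun p => smul_add (f p) (s p) (t p))
  add_smul := by
    rintro ⟨f⟩ ⟨g⟩ ⟨s⟩
    exact congrArg (secGerm x) (funext fun p => add_smul (f p) (g p) (s p))
  zero_smul := by
    rintro ⟨s⟩
    exact congrArg (secGerm x) (funext fun p => zero_smul ℂ (s p))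

end Germs

section Sheaves

variable {W : RiemannSphere → Type*} [∀ p, AddCommGroup (W p)]

/-- Extension by zero of a section over an open set. All notions below only look at this extension
near points of the open set. -/
def extendZero (U : Opens RiemannSphere) (s : ∀ p : U, W p) : ∀ p, W p :=
  fun p => open Classical in if h : p ∈ U then s ⟨p, h⟩ else 0

theorem extendZero_of_mem {U : Opens RiemannSphere} (s : ∀ p : U, W p) {p : RiemannSphere}
    (h : p ∈ U) : extendZero U s p = s ⟨p, h⟩ := by
  simp [extendZero, h]

theorem extendZero_add (U : Opens RiemannSphere) (s t : ∀ p : U, W p) :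
    extendZero U (s + t) = extendZero U s + extendZero U t := by
  funext p
  by_cases h : p ∈ U <;> simp [extendZero, h]

theorem extendZero_zero (U : Opens RiemannSphere) :
    extendZero U (0 : ∀ p : U, W p) = 0 := by
  funext p
  by_cases h : p ∈ U <;> simp [extendZero, h]

/-- Restriction of sections to a smaller open set. -/
def restrictSec {U V : Opens RiemannSphere} (h : V ≤ U) (s : ∀ p : U, W p) : ∀ p : V, W p :=
  fun p => s ⟨p, h p.2⟩

theorem extendZero_restrictSec {U V : Opens RiemannSphere} (h : V ≤ U) (s : ∀ p : U, W p)
    {x : RiemannSphere} (hx : x ∈ V) :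
    ∀ᶠ p in 𝓝 x, extendZero V (restrictSec h s) p = extendZero U s p := by
  filter_upwards [V.2.mem_nhds hx] with p hp
  rw [extendZero_of_mem _ hp, extendZero_of_mem _ (h hp)]
  rfl

variable [∀ p, Module ℂ (W p)]

theorem extendZero_smul (U : Opens RiemannSphere) (f : U → ℂ) (s : ∀ p : U, W p) :
    extendZero U (f • s) = fun p => extendZero (W := fun _ => ℂ) U f p • extendZero U s p := by
  funext p
  by_cases h : p ∈ U <;> simp [extendZero, h]

theorem HolAt.congr {f g : RiemannSphere → ℂ} {p : RiemannSphere} (hf : HolAt f p)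
    (h : ∀ᶠ q in 𝓝 p, g q = f q) : HolAt g p :=
  ContMDiffAt.congr_of_eventuallyEq hf h

/-- The ring `𝒪(U)` of holomorphic functions on an open subset of the Riemann sphere. -/
def holFun (U : Opens RiemannSphere) : Subring (U → ℂ) where
  carrier := {f | ∀ p ∈ U, HolAt (extendZero (W := fun _ => ℂ) U f) p}
  mul_mem' := by
    intro f g hf hg p hp
    have h := extendZero_smul (W := fun _ => ℂ) U f g
    rw [show f * g = f • g from rfl, h]
    exact ContMDiffAt.mul (hf p hp) (hg p hp)
  one_mem' := by
    intro p hp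
    have h1 : HolAt (fun _ => 1) p := contMDiffAt_const
    refine h1.congr ?_
    filter_upwards [U.2.mem_nhds hp] with q hq
    exact extendZero_of_mem (W := fun _ => ℂ) _ hq
  add_mem' := by
    intro f g hf hg p hp
    rw [extendZero_add (W := fun _ => ℂ)]
    exact ContMDiffAt.add (hf p hp) (hg p hp)
  zero_mem' := by
    intro p hp
    rw [extendZero_zero (W := fun _ => ℂ)]
    exact contMDiffAt_const
  neg_mem' := by
    intro f hf p hp
    have h1 : HolAt (-extendZero (W := fun _ => ℂ) U f) p := ContMDiffAt.neg (hf p hp)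
    refine h1.congr ?_
    filter_upwards [U.2.mem_nhds hp] with q hq
    simp [extendZero_of_mem (W := fun _ => ℂ) _ hq]

variable (W) in
/-- A sheaf of `𝒪`-modules on the Riemann sphere whose sections over `U` are functions on `U` with
values in the spaces `W p`: a submodule of such functions for each `U`, compatible with restriction,
such that membership is a local condition. -/
structure SectionSheaf where
  sections : ∀ U : Opens RiemannSphere, Submodule (holFun U) (∀ p : U, W p)
  restrict_mem : ∀ {U V : Opens RiemannSphere} (h : V ≤ U) {s : ∀ p : U, W p},
    s ∈ sections U → restrictSec h s ∈ sections V
  locality : ∀ {U : Opens RiemannSphere} {s : ∀ p : U, W p},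
    (∀ p ∈ U, ∃ V : Opens RiemannSphere, ∃ h : V ≤ U, p ∈ V ∧ restrictSec h s ∈ sections V) →
      s ∈ sections U

/-- The restriction maps of the sheaf. -/
def SectionSheaf.res (𝓕 : SectionSheaf W) {U V : Opens RiemannSphere} (h : V ≤ U)
    (s : 𝓕.sections U) : 𝓕.sections V :=
  ⟨restrictSec h s.1, 𝓕.restrict_mem h s.2⟩

/-- An isomorphism of sheaves of `𝒪`-modules. -/
structure SheafIso {W' : RiemannSphere → Type*} [∀ p, AddCommGroup (W' p)]
    [∀ p, Module ℂ (W' p)] (𝓕 : SectionSheaf W) (𝓖 : SectionSheaf W') where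
  equiv : ∀ U : Opens RiemannSphere, 𝓕.sections U ≃ₗ[holFun U] 𝓖.sections U
  naturality : ∀ {U V : Opens RiemannSphere} (h : V ≤ U) (s : 𝓕.sections U),
    equiv V (𝓕.res h s) = 𝓖.res h (equiv U s)

end Sheaves

section LineBundles

/-- The expression near `∞` of a section of `𝒪(a)`, in the trivialisation over `ℙ¹ ∖ {0}`. -/
def inftyTwist (a : ℤ) (f : RiemannSphere → ℂ) : RiemannSphere → ℂ :=
  fun p => p.elim (f OnePoint.infty) (fun z => z ^ (-a) * f z)

/-- `f` is, at `p`, a holomorphic section of the line bundle `𝒪(a)` of degree `a`. This is the line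
bundle obtained by gluing the trivial line bundles over `ℂ` and `ℙ¹ ∖ {0}` by
`f₀(z) = z ^ a * f_∞(z)`. A section is given by its values in the first trivialisation at the points
of `ℂ`, and by its value in the second one at `∞`. -/
def HolTwistAt (a : ℤ) (f : RiemannSphere → ℂ) (p : RiemannSphere) : Prop :=
  (p = OnePoint.infty → HolAt (inftyTwist a f) p) ∧ (p ≠ OnePoint.infty → HolAt f p)

theorem HolTwistAt.congr {a : ℤ} {f g : RiemannSphere → ℂ} {p : RiemannSphere}
    (hf : HolTwistAt a f p) (h : ∀ᶠ q in 𝓝 p, g q = f q) : HolTwistAt a g p := by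
  refine ⟨fun hp => (hf.1 hp).congr ?_, fun hp => (hf.2 hp).congr h⟩
  filter_upwards [h] with q hq
  induction q using OnePoint.rec with
  | infty => simpa [inftyTwist] using hq
  | coe z => simp [inftyTwist, hq]

theorem HolTwistAt.add {a : ℤ} {f g : RiemannSphere → ℂ} {p : RiemannSphere}
    (hf : HolTwistAt a f p) (hg : HolTwistAt a g p) : HolTwistAt a (f + g) p := by
  refine ⟨fun hp => ?_, fun hp => ContMDiffAt.add (hf.2 hp) (hg.2 hp)⟩
  refine HolAt.congr (ContMDiffAt.add (hf.1 hp) (hg.1 hp)) (Filter.Eventually.of_forall fun q => ?_)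
  induction q using OnePoint.rec with
  | infty => simp [inftyTwist]
  | coe z => simp [inftyTwist, mul_add]

theorem HolTwistAt.mul {a : ℤ} {f g : RiemannSphere → ℂ} {p : RiemannSphere}
    (hf : HolAt f p) (hg : HolTwistAt a g p) : HolTwistAt a (fun q => f q * g q) p := by
  refine ⟨fun hp => ?_, fun hp => ContMDiffAt.mul hf (hg.2 hp)⟩
  refine HolAt.congr (ContMDiffAt.mul hf (hg.1 hp)) (Filter.Eventually.of_forall fun q => ?_)
  induction q using OnePoint.rec with
  | infty => simp [inftyTwist]
  | coe z => simp [inftyTwist, mul_left_comm]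

theorem HolTwistAt.zero (a : ℤ) (p : RiemannSphere) : HolTwistAt a 0 p := by
  have h0 : HolAt 0 p := contMDiffAt_const
  refine ⟨fun _ => h0.congr (Filter.Eventually.of_forall fun q => ?_), fun _ => h0⟩
  induction q using OnePoint.rec with
  | infty => simp [inftyTwist]
  | coe z => simp [inftyTwist]

/-- The sheaf `𝒪(a₁) ⊕ ⋯ ⊕ 𝒪(aₙ)`. -/
def sumO {n : ℕ} (a : Fin n → ℤ) : SectionSheaf (fun _ => Fin n → ℂ) where
  sections U :=
    { carrier := {s | ∀ p ∈ U, ∀ i,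
        HolTwistAt (a i) (fun q => extendZero (W := fun _ => Fin n → ℂ) U s q i) p}
      add_mem' := by
        intro s t hs ht p hp i
        rw [extendZero_add (W := fun _ => Fin n → ℂ)]
        exact (hs p hp i).add (ht p hp i)
      zero_mem' := by
        intro p hp i
        rw [extendZero_zero (W := fun _ => Fin n → ℂ)]
        exact HolTwistAt.zero (a i) p
      smul_mem' := by
        intro f s hs p hp i
        have h := extendZero_smul (W := fun _ => Fin n → ℂ) U f.1 s
        rw [show f • s = f.1 • s from rfl, h]
        exact HolTwistAt.mul (f.2 p hp) (hs p hp i) }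
  restrict_mem := by
    intro U V h s hs p hp i
    refine (hs p (h hp) i).congr ?_
    filter_upwards [extendZero_restrictSec (W := fun _ => Fin n → ℂ) h s hp] with q hq
    rw [hq]
  locality := by
    intro U s hs p hp i
    obtain ⟨V, h, hpV, hV⟩ := hs p hp
    refine (hV p hpV i).congr ?_
    filter_upwards [extendZero_restrictSec (W := fun _ => Fin n → ℂ) h s hpV] with q hq
    rw [hq]

end LineBundles

section VectorBundles

variable {n : ℕ} (E : RiemannSphere → Type*) [∀ p, AddCommGroup (E p)] [∀ p, Module ℂ (E p)]
  [∀ p, TopologicalSpace (E p)] [TopologicalSpace (TotalSpace (Fin n → ℂ) E)]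
  [FiberBundle (Fin n → ℂ) E]

/-- A section of the rank `n` bundle `E` is holomorphic at (hence near) `p`. -/
def HolSecAt (n : ℕ) {E : RiemannSphere → Type*} [∀ p, TopologicalSpace (E p)]
    [TopologicalSpace (TotalSpace (Fin n → ℂ) E)] [FiberBundle (Fin n → ℂ) E]
    (s : ∀ p, E p) (p : RiemannSphere) : Prop :=
  ContMDiffAt 𝓘(ℂ) (𝓘(ℂ).prod 𝓘(ℂ, Fin n → ℂ)) ω (fun q => TotalSpace.mk' (Fin n → ℂ) q (s q)) p

theorem HolSecAt.congr {E : RiemannSphere → Type*} [∀ p, TopologicalSpace (E p)]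
    [TopologicalSpace (TotalSpace (Fin n → ℂ) E)] [FiberBundle (Fin n → ℂ) E]
    {s t : ∀ p, E p} {p : RiemannSphere} (hs : HolSecAt n s p) (h : ∀ᶠ q in 𝓝 p, t q = s q) :
    HolSecAt n t p := by
  refine ContMDiffAt.congr_of_eventuallyEq hs ?_
  filter_upwards [h] with q hq
  rw [hq]

variable [VectorBundle ℂ (Fin n → ℂ) E]

theorem HolSecAt.zero (p : RiemannSphere) : HolSecAt n (0 : ∀ p, E p) p :=
  (Bundle.contMDiff_zeroSection ℂ E).contMDiffAt

variable (n)

/-- The sheaf of holomorphic sections of the vector bundle `E`. -/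
def bundleSheaf : SectionSheaf E where
  sections U :=
    { carrier := {s | ∀ p ∈ U, HolSecAt n (extendZero U s) p}
      add_mem' := by
        intro s t hs ht p hp
        rw [extendZero_add]
        exact ContMDiffAt.add_section (hs p hp) (ht p hp)
      zero_mem' := by
        intro p hp
        rw [extendZero_zero]
        exact HolSecAt.zero E p
      smul_mem' := by
        intro f s hs p hp
        rw [show f • s = f.1 • s from rfl, extendZero_smul]
        exact ContMDiffAt.smul_section (f.2 p hp) (hs p hp) }
  restrict_mem := by
    intro U V h s hs p hp
    exact (hs p (h hp)).congr (extendZero_restrictSec h s hp)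
  locality := by
    intro U s hs p hp
    obtain ⟨V, h, hpV, hV⟩ := hs p hp
    refine (hV p hpV).congr ?_
    filter_upwards [extendZero_restrictSec h s hpV] with q hq
    rw [hq]

/-- The stalk at `x` of the sheaf of holomorphic sections of `E`. -/
def stalkLattice (x : RiemannSphere) : Submodule (holGerm x) (SecGerm E x) where
  carrier := {g | ∃ s : ∀ p, E p, HolSecAt n s x ∧ g = secGerm x s}
  add_mem' := by
    rintro _ _ ⟨s, hs, rfl⟩ ⟨t, ht, rfl⟩
    exact ⟨s + t, ContMDiffAt.add_section hs ht, rfl⟩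
  zero_mem' := ⟨0, HolSecAt.zero E x, rfl⟩
  smul_mem' := by
    rintro ⟨_, f, hf, rfl⟩ _ ⟨s, hs, rfl⟩
    exact ⟨fun p => f p • s p, ContMDiffAt.smul_section hf hs, rfl⟩

/-- The meromorphic stalk `V_x = 𝓔_x ⊗ K_x`: the germs at `x` of meromorphic sections of `E`. -/
def merStalk (x : RiemannSphere) : Submodule (merGerm x) (SecGerm E x) :=
  Submodule.span (merGerm x) (stalkLattice n E x : Set (SecGerm E x))

/-- A lattice at `x`: the `𝒪_x`-module spanned by some `K_x`-basis of `V_x`. -/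
def IsLattice {x : RiemannSphere} (M : Submodule (holGerm x) (SecGerm E x)) : Prop :=
  ∃ e : Module.Basis (Fin n) (merGerm x) (merStalk n E x),
    M = Submodule.span (holGerm x) (Set.range fun i => (e i : SecGerm E x))

variable {E}

/-- The modified bundle `𝓔^M` for a lattice `M` at `x`. Its sections over `U` are the holomorphic
sections of `E` over `U ∖ {x}` whose germ at `x`, in case `x ∈ U`, belongs to `M`. As such a section
is determined by its values off `x`, its value at `x` is put equal to `0`. -/
def modifiedSheaf {x : RiemannSphere} (M : Submodule (holGerm x) (SecGerm E x)) :
    SectionSheaf E where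
  sections U :=
    { carrier := {s | (∀ p ∈ U, p ≠ x → HolSecAt n (extendZero U s) p) ∧
        (x ∈ U → secGerm x (extendZero U s) ∈ M ∧ extendZero U s x = 0)}
      add_mem' := by
        rintro s t ⟨hs, hs'⟩ ⟨ht, ht'⟩
        rw [Set.mem_ofPred_eq, extendZero_add]
        refine ⟨fun p hp hpx => ContMDiffAt.add_section (hs p hp hpx) (ht p hp hpx), fun hx => ?_⟩
        refine ⟨M.add_mem (hs' hx).1 (ht' hx).1, ?_⟩
        rw [Pi.add_apply, (hs' hx).2, (ht' hx).2, add_zero]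
      zero_mem' := by
        rw [Set.mem_ofPred_eq, extendZero_zero]
        exact ⟨fun p _ _ => HolSecAt.zero E p, fun _ => ⟨M.zero_mem, rfl⟩⟩
      smul_mem' := by
        rintro f s ⟨hs, hs'⟩
        rw [Set.mem_ofPred_eq, show f • s = f.1 • s from rfl, extendZero_smul]
        refine ⟨fun p hp hpx => ContMDiffAt.smul_section (f.2 p hp) (hs p hp hpx), fun hx => ?_⟩
        refine ⟨M.smul_mem ⟨_, _, f.2 x hx, rfl⟩ (hs' hx).1, ?_⟩
        simp only [(hs' hx).2, smul_zero] }
  restrict_mem := by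
    rintro U V h s ⟨hs, hs'⟩
    refine ⟨fun p hp hpx => (hs p (h hp) hpx).congr (extendZero_restrictSec h s hp), fun hx => ?_⟩
    have he := extendZero_restrictSec h s hx
    rw [secGerm_eq_iff.2 (he.filter_mono nhdsWithin_le_nhds), he.self_of_nhds]
    exact hs' (h hx)
  locality := by
    intro U s hs
    refine ⟨fun p hp hpx => ?_, fun hx => ?_⟩
    · obtain ⟨V, h, hpV, hV⟩ := hs p hp
      refine (hV.1 p hpV hpx).congr ?_
      filter_upwards [extendZero_restrictSec h s hpV] with q hq
      rw [hq]
    · obtain ⟨V, h, hpV, hV⟩ := hs x hx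
      have he := extendZero_restrictSec h s hpV
      rw [← secGerm_eq_iff.2 (he.filter_mono nhdsWithin_le_nhds), ← he.self_of_nhds]
      exact hV.2 hpV

variable (E) in
/-- `a` is the type of `E`: it is non-increasing and `𝓔 ≃ 𝒪(a₁) ⊕ ⋯ ⊕ 𝒪(aₙ)`. -/
def HasType (a : Fin n → ℤ) : Prop :=
  Antitone a ∧ Nonempty (SheafIso (bundleSheaf n E) (sumO a))

variable {n}

end VectorBundles

section ElementaryDivisors

variable {n : ℕ} {E : RiemannSphere → Type*} [∀ p, AddCommGroup (E p)] [∀ p, Module ℂ (E p)]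

/-- The family `e` is an `𝒪_x`-basis of `M`. -/
def IsHolBasis {x : RiemannSphere} (M : Submodule (holGerm x) (SecGerm E x))
    (e : Fin n → SecGerm E x) : Prop :=
  LinearIndependent (holGerm x) e ∧ Submodule.span (holGerm x) (Set.range e) = M

/-- `k₁ ≤ ⋯ ≤ kₙ` are the elementary divisors of `N` in `M`. -/
def IsElementaryDivisors {x : RiemannSphere} (M N : Submodule (holGerm x) (SecGerm E x))
    (k : Fin n → ℤ) : Prop :=
  Monotone k ∧ ∃ e : Fin n → SecGerm E x,
    IsHolBasis M e ∧ IsHolBasis N (fun i => coordPow x (k i) • e i)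

/-- The normalised sequence `k - min k`. -/
def normalised (k : Fin n → ℤ) (i : Fin n) : ℤ := k i - ⨅ j, k j

/-- The number `d = max k - min k` of terms of the elementary splitting. -/
def splittingLength (k : Fin n → ℤ) : ℕ := (⨆ i, normalised k i).toNat

/-- The `j`-th term `T_j` of the elementary splitting `k - min k = T_1 + ⋯ + T_d`, that is, the
difference of the truncations of `k - min k` at `j` and at `j - 1`. -/
def elementarySplitting (k : Fin n → ℤ) (j : ℕ) (i : Fin n) : ℤ :=
  min (normalised k i) j - min (normalised k i) (j - 1)

end ElementaryDivisors

end

/-! Let $w$ be the local coordinate at $x$. A trivialisation $\mathcal E^M\simeq\mathcal O(m)^n$ and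
a basis of $M$ adapted to $\mathcal E_x$ give a matrix $G\in GL_n(\mathcal O_x)$ for which $\mathcal
E_x$ becomes the lattice $G w^k\mathcal O_x^n$ (`isInvertibleOver_frameMatrix`,
`secGerm_mem_stalkLattice_iff`). Suppose $G w^k=P(1/w)\,w^b H$ with $P$ invertible over $\mathbb
C[X]$ and $H\in GL_n(\mathcal O_x)$. Since $1/w$ is the germ of a global function with its only pole
at $x$, $P(1/w)^{-1}$ is an automorphism of $\mathcal O(m)^n$ off $x$. It turns the stalk of
$\mathcal E$ into $w^b\mathcal O_x^n$, whence $\mathcal E\simeq\bigoplus\mathcal O(m-b_i)$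
(`nonempty_sheafIso_sumO`).

The factorisation is built one term $\varepsilon=T_j\in\{0,1\}^n$ at a time, by moving
$w^\varepsilon$ to the left of an invertible $H$ (`diagPow_mul_mul_diagPow`). A Bruhat decomposition
of $H(x)$ with respect to the parabolic defined by $\varepsilon$ provides a triangular constant
matrix $C$ and a permutation $\rho$ such that $w^{-\rho\varepsilon}C^{-1}Hw^{\varepsilon}$ is again
invertible over $\mathcal O_x$. Triangularity of $C$ is taken in the order of the exponents $b$
already collected, so that $w^bCw^{-b}$ is a polynomial in $1/w$ and joins $P$. Each step adds a
permuted $T_j$ to $b$, which is the asserted formula.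

Uniqueness of the type is Liouville's theorem: in the matrix of an isomorphism $\bigoplus\mathcal
O(a_j)\to\bigoplus\mathcal O(b_i)$ the entries with $b_i<a_j$ vanish, and a nonzero term of its
determinant matches the degrees (`SheafIso.exists_perm_le`).

The algebra is done in a commutative ring $K$ with a subring $O$ and a unit $w$, because the ring of
all punctured germs of functions is not a field; invertibility over $O$ is expressed through
determinants. -/

noncomputable section

open RiemannSphere

/-! ### Echelon forms and a Bruhat decomposition over a field -/

section EchelonForm

variable {F ι : Type*} [Field F] [Fintype ι]

/-- Such a map embeds $F^S$ in $F^Z$, so dimensions can be compared. Applied to a matrix and to its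
inverse, this shows that a pivot set has the expected size. -/
theorem card_le_of_injective_of_support {B : (ι → F) →ₗ[F] (ι → F)} (hB : Function.Injective B)
    {S Z : Finset ι} (h : ∀ u : ι → F, (∀ t ∉ S, u t = 0) → ∀ t ∉ Z, B u t = 0) :
    S.card ≤ Z.card := by
  classical
  let g : (S → F) →ₗ[F] (Z → F) :=
    (LinearMap.funLeft F F (Subtype.val : Z → ι)) ∘ₗ B ∘ₗ
      (Function.ExtendByZero.linearMap F (Subtype.val : S → ι))
  have hg : Function.Injective g := by
    rw [← LinearMap.ker_eq_bot, LinearMap.ker_eq_bot']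
    intro u hu
    have hsupp : ∀ t ∉ S, Function.extend (Subtype.val : S → ι) u 0 t = 0 := by
      intro t ht
      rw [Function.extend_apply' _ _ _ (by rintro ⟨a, rfl⟩; exact ht a.2)]
      rfl
    have h0 : B (Function.extend (Subtype.val : S → ι) u 0) = 0 := by
      funext t
      by_cases ht : t ∈ Z
      · exact congrFun hu ⟨t, ht⟩
      · exact h _ hsupp t ht
    have h1 := hB (h0.trans (map_zero B).symm)
    funext s
    have := congrFun h1 s
    rwa [Subtype.val_injective.extend_apply] at this
  simpa using LinearMap.finrank_le_finrank_of_injective hg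

variable [LinearOrder ι]

/-- A subspace of `F ^ ι` is carried to a coordinate subspace by a unitriangular matrix. -/
theorem exists_unitriangular_mulVec_mem_iff (W : Submodule F (ι → F)) :
    ∃ (C : Matrix ι ι F) (S : Finset ι), C.BlockTriangular id ∧ C.det = 1 ∧
      ∀ u, C.mulVec u ∈ W ↔ ∀ t ∉ S, u t = 0 := by
  classical
  -- The pivots of `W`: the positions of the last nonzero entry of its vectors. The columns of `C`
  -- are vectors of `W` at the pivots and standard basis vectors elsewhere.
  let S : Finset ι := Finset.univ.filter fun s => ∃ w ∈ W, w s = 1 ∧ ∀ t, s < t → w t = 0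
  have hS : ∀ s, ∃ w : ι → F, w s = 1 ∧ (∀ t, s < t → w t = 0) ∧ (s ∈ S → w ∈ W) ∧
      (s ∉ S → w = Pi.single s 1) := by
    intro s
    by_cases hs : s ∈ S
    · obtain ⟨w, hw, h1, h2⟩ := (Finset.mem_filter.1 hs).2
      exact ⟨w, h1, h2, fun _ => hw, fun h => absurd hs h⟩
    · exact ⟨Pi.single s 1, by simp, fun t ht => by simp [ht.ne'], fun h => absurd h hs,
        fun _ => rfl⟩
  choose w w1 w2 w3 w4 using hS
  have hC : (Matrix.of fun i j => w j i : Matrix ι ι F).BlockTriangular id :=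
    fun i j hij => w2 j i hij
  have hmul : ∀ u, (Matrix.of fun i j => w j i : Matrix ι ι F).mulVec u = ∑ s, u s • w s := by
    intro u
    funext i
    simp [Matrix.mulVec, dotProduct, mul_comm]
  refine ⟨Matrix.of fun i j => w j i, S, hC, ?_, fun u => ?_⟩
  · rw [Matrix.det_of_isUpperTriangular hC]
    simp [w1]
  · rw [hmul]
    constructor
    · intro hu
      by_contra! hne
      obtain ⟨t₀, ht₀, hut₀⟩ := hne
      -- Removing the pivot columns leaves a vector of `W` supported off `S`. If it were nonzero,
      -- its last nonzero position would be a pivot outside `S`.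
      let r : ι → F := ∑ s ∈ Sᶜ, u s • w s
      have hr : r ∈ W := by
        have h1 : r = ∑ s, u s • w s - ∑ s ∈ S, u s • w s := by
          rw [eq_sub_iff_add_eq]
          exact Finset.sum_compl_add_sum S _
        rw [h1]
        exact W.sub_mem hu (W.sum_mem fun s hs => W.smul_mem _ (w3 s hs))
      have hr' : ∀ t, r t = if t ∈ S then 0 else u t := by
        intro t
        have h1 : r = ∑ s ∈ Sᶜ, u s • Pi.single s 1 :=
          Finset.sum_congr rfl fun s hs => by rw [w4 s (Finset.mem_compl.1 hs)]
        rw [h1]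
        simp [Finset.sum_apply, Pi.single_apply]
      have hne : (Finset.univ.filter fun t => r t ≠ 0).Nonempty :=
        ⟨t₀, by simp [hr', ht₀, hut₀]⟩
      obtain ⟨t, ht, hmax⟩ := Finset.exists_max_image _ id hne
      have hrt : r t ≠ 0 := (Finset.mem_filter.1 ht).2
      have htS : t ∉ S := by
        intro h
        exact hrt (by rw [hr', if_pos h])
      refine htS (Finset.mem_filter.2 ⟨Finset.mem_univ _, (r t)⁻¹ • r, W.smul_mem _ hr, ?_, ?_⟩)
      · simp [hrt]
      · intro t' ht'
        have : r t' = 0 := by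
          by_contra h
          exact absurd (hmax t' (by simp [h])) (not_le.2 ht')
        simp [this]
    · intro hu
      refine W.sum_mem fun s _ => ?_
      by_cases hs : s ∈ S
      · exact W.smul_mem _ (w3 s hs)
      · rw [hu s hs, zero_smul]
        exact W.zero_mem

/-- A form of the Bruhat decomposition relative to a maximal parabolic subgroup. -/
theorem exists_triangular_perm_inv_mul_apply_eq_zero {A : Matrix ι ι F} (hA : IsUnit A.det)
    (Z : Finset ι) :
    ∃ (C : Matrix ι ι F) (ρ : Equiv.Perm ι), C.BlockTriangular id ∧ C.det = 1 ∧
      ∀ i j, i ∉ Z → j ∈ Z → (C⁻¹ * A) (ρ i) j = 0 := by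
  classical
  -- `W` is the image under `A` of the coordinate subspace $F^Z$; in echelon form it becomes $F^S$,
  -- so $C^{-1}A$ maps $F^Z$ onto $F^S$.
  let W : Submodule F (ι → F) :=
    { carrier := {y | ∀ t ∉ Z, A⁻¹.mulVec y t = 0}
      add_mem' := fun {a b} ha hb t ht => by
        rw [Matrix.mulVec_add, Pi.add_apply, ha t ht, hb t ht, add_zero]
      zero_mem' := fun t _ => by rw [Matrix.mulVec_zero]; rfl
      smul_mem' := fun c y hy t ht => by
        rw [Matrix.mulVec_smul, Pi.smul_apply, hy t ht, smul_zero] }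
  have hWmem : ∀ y, y ∈ W ↔ ∀ t ∉ Z, A⁻¹.mulVec y t = 0 := fun y => Iff.rfl
  obtain ⟨C, S, hC, hdet, hW⟩ := exists_unitriangular_mulVec_mem_iff W
  have hCu : IsUnit C.det := by rw [hdet]; exact isUnit_one
  have hinj : ∀ B B' : Matrix ι ι F, B * B' = 1 → Function.Injective (Matrix.toLin' B') := by
    intro B B' h u v huv
    simp only [Matrix.toLin'_apply] at huv
    simpa [h] using congrArg (B.mulVec) huv
  have h1 : S.card ≤ Z.card := by
    refine card_le_of_injective_of_support (B := Matrix.toLin' (A⁻¹ * C))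
      (hinj (C⁻¹ * A) _ ?_) fun u hu => ?_
    · rw [Matrix.mul_assoc, ← Matrix.mul_assoc A, Matrix.mul_nonsing_inv _ hA, Matrix.one_mul,
        Matrix.nonsing_inv_mul _ hCu]
    · rw [Matrix.toLin'_apply, ← Matrix.mulVec_mulVec]
      exact (hWmem _).1 ((hW u).2 hu)
  have hZS : ∀ u : ι → F, (∀ t ∉ Z, u t = 0) → ∀ t ∉ S, (C⁻¹ * A).mulVec u t = 0 := by
    intro u hu
    refine (hW _).1 ?_
    rw [Matrix.mulVec_mulVec, ← Matrix.mul_assoc, Matrix.mul_nonsing_inv _ hCu, Matrix.one_mul,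
      hWmem, Matrix.mulVec_mulVec, Matrix.nonsing_inv_mul _ hA, Matrix.one_mulVec]
    exact hu
  have h2 : Z.card ≤ S.card := by
    refine card_le_of_injective_of_support (B := Matrix.toLin' (C⁻¹ * A))
      (hinj (A⁻¹ * C) _ ?_) fun u hu => ?_
    · rw [Matrix.mul_assoc, ← Matrix.mul_assoc C, Matrix.mul_nonsing_inv _ hCu, Matrix.one_mul,
        Matrix.nonsing_inv_mul _ hA]
    · exact hZS u hu
  -- Any permutation carrying `Z` to `S` serves as `ρ`: it sends the complement of `Z` to rows
  -- outside `S`, where $C^{-1}A$ kills the columns in `Z`.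
  let e : {i // i ∈ Z} ≃ {i // i ∈ S} := Fintype.equivOfCardEq (by simpa using h2.antisymm h1)
  refine ⟨C, e.extendSubtype, hC, hdet, fun i j hi hj => ?_⟩
  have h3 := hZS (Pi.single j 1) (fun t ht => Pi.single_eq_of_ne (by rintro rfl; exact ht hj) 1)
    (e.extendSubtype i) (e.extendSubtype_not_mem i hi)
  simpa using h3

end EchelonForm

/-! ### Factorisation of $G w^k$ over an abstract local ring of germs -/

section LocalFactorisation

variable {K F : Type*} [CommRing K] [Field F] {n : ℕ}

/-- The matrices that are invertible over the subring `O`. -/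
def IsInvertibleOver (O : Subring K) (H : Matrix (Fin n) (Fin n) K) : Prop :=
  (∀ i j, H i j ∈ O) ∧ ∃ d ∈ O, H.det * d = 1

theorem det_mem_subring {O : Subring K} {H : Matrix (Fin n) (Fin n) K} (h : ∀ i j, H i j ∈ O) :
    H.det ∈ O := by
  rw [Matrix.det_apply']
  exact O.sum_mem fun σ _ => O.mul_mem (by simp) (O.prod_mem fun i _ => h _ _)

theorem mul_mem_subring {O : Subring K} {H H' : Matrix (Fin n) (Fin n) K} (h : ∀ i j, H i j ∈ O)
    (h' : ∀ i j, H' i j ∈ O) (i j : Fin n) : (H * H') i j ∈ O := by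
  rw [Matrix.mul_apply]
  exact O.sum_mem fun l _ => O.mul_mem (h i l) (h' l j)

theorem mulVec_mem_subring {O : Subring K} {H : Matrix (Fin n) (Fin n) K} (h : ∀ i j, H i j ∈ O)
    {r : Fin n → K} (hr : ∀ i, r i ∈ O) (i : Fin n) : H.mulVec r i ∈ O := by
  rw [Matrix.mulVec, dotProduct]
  exact O.sum_mem fun j _ => O.mul_mem (h i j) (hr j)

theorem isInvertibleOver_of_mul_eq_one {O : Subring K} {H H' : Matrix (Fin n) (Fin n) K}
    (h : ∀ i j, H i j ∈ O) (h' : ∀ i j, H' i j ∈ O) (hH : H * H' = 1) : IsInvertibleOver O H :=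
  ⟨h, H'.det, det_mem_subring h', by rw [← Matrix.det_mul, hH, Matrix.det_one]⟩

theorem IsInvertibleOver.exists_inverse {O : Subring K} {H : Matrix (Fin n) (Fin n) K}
    (h : IsInvertibleOver O H) :
    ∃ H' : Matrix (Fin n) (Fin n) K, (∀ i j, H' i j ∈ O) ∧ H * H' = 1 ∧ H' * H = 1 := by
  obtain ⟨h, d, hd, hdet⟩ := h
  have h1 : H * (d • H.adjugate) = 1 := by
    rw [Matrix.mul_smul, Matrix.mul_adjugate, smul_smul, mul_comm d, hdet, one_smul]
  refine ⟨d • H.adjugate, fun i j => ?_, h1, mul_eq_one_comm.1 h1⟩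
  rw [Matrix.smul_apply, smul_eq_mul, Matrix.adjugate_apply]
  refine O.mul_mem hd (det_mem_subring fun a b => ?_)
  rw [Matrix.updateRow_apply]
  split_ifs
  · rw [Pi.single_apply]
    split_ifs
    exacts [O.one_mem, O.zero_mem]
  · exact h a b

/-- The diagonal matrix with entries `w ^ b i`. -/
def diagPow (w : Kˣ) (b : Fin n → ℤ) : Matrix (Fin n) (Fin n) K :=
  Matrix.diagonal fun i => ((w ^ b i : Kˣ) : K)

theorem diagPow_mul (w : Kˣ) (b c : Fin n → ℤ) :
    diagPow w b * diagPow w c = diagPow w (b + c) := by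
  simp [diagPow, Matrix.diagonal_mul_diagonal, zpow_add]

theorem diagPow_neg_mul (w : Kˣ) (b : Fin n → ℤ) : diagPow w (-b) * diagPow w b = 1 := by
  rw [diagPow_mul, neg_add_cancel]
  simp [diagPow]

/-- The value at `w⁻¹` of a matrix of polynomials. -/
def evalInv (φ : F →+* K) (w : Kˣ) (P : Matrix (Fin n) (Fin n) (Polynomial F)) :
    Matrix (Fin n) (Fin n) K :=
  P.map (Polynomial.eval₂RingHom φ ((w⁻¹ : Kˣ) : K))

theorem evalInv_mul (φ : F →+* K) (w : Kˣ) (P Q : Matrix (Fin n) (Fin n) (Polynomial F)) :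
    evalInv φ w (P * Q) = evalInv φ w P * evalInv φ w Q := Matrix.map_mul

theorem evalInv_one (φ : F →+* K) (w : Kˣ) :
    evalInv φ w (1 : Matrix (Fin n) (Fin n) (Polynomial F)) = 1 :=
  Matrix.map_one _ (map_zero _) (map_one _)

/-- Conjugation of a constant matrix by `w ^ b`, in case the result is a polynomial in `w⁻¹`. -/
def conjPow (b : Fin n → ℤ) (C : Matrix (Fin n) (Fin n) F) :
    Matrix (Fin n) (Fin n) (Polynomial F) :=
  Matrix.of fun i j => Polynomial.C (C i j) * Polynomial.X ^ (b j - b i).toNat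

/-- The entry $C_{ij}w^{b_i-b_j}$ of $w^bCw^{-b}$ is a constant times a nonnegative power of $1/w$
when $b_i\le b_j$. The other entries vanish by triangularity, so the truncation by `toNat` is
harmless. -/
theorem evalInv_conjPow (φ : F →+* K) (w : Kˣ) {b : Fin n → ℤ} {C : Matrix (Fin n) (Fin n) F}
    (hC : C.BlockTriangular b) :
    evalInv φ w (conjPow b C) * diagPow w b = diagPow w b * C.map φ := by
  ext i j
  rw [diagPow, Matrix.mul_diagonal, Matrix.diagonal_mul]
  by_cases h : b j < b i
  · simp [evalInv, conjPow, hC h]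
  · have h1 : ((w⁻¹ : Kˣ) : K) ^ (b j - b i).toNat = ((w ^ (b i - b j) : Kˣ) : K) := by
      rw [← Units.val_pow_eq_pow_val, inv_pow, ← zpow_natCast, ← zpow_neg]
      congr 2
      omega
    have h2 : evalInv φ w (conjPow b C) i j = φ (C i j) * ((w⁻¹ : Kˣ) : K) ^ (b j - b i).toNat := by
      simp only [evalInv, conjPow, Matrix.map_apply, Matrix.of_apply, Polynomial.coe_eval₂RingHom,
        Polynomial.eval₂_mul, Polynomial.eval₂_pow, Polynomial.eval₂_C, Polynomial.eval₂_X]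
    rw [h2, h1, Matrix.map_apply, mul_assoc, ← Units.val_mul, ← zpow_add, sub_add_cancel, mul_comm]

/-- Only indices $l$ with $b_i\le b_l\le b_j$ contribute, and along them the exponents add. Hence
the conjugate of an invertible triangular matrix is invertible over the polynomials. -/
theorem conjPow_mul_conjPow {b : Fin n → ℤ} {C C' : Matrix (Fin n) (Fin n) F}
    (hC : C.BlockTriangular b) (hC' : C'.BlockTriangular b) :
    conjPow b C * conjPow b C' = conjPow b (C * C') := by
  ext1 i j
  simp only [Matrix.mul_apply, conjPow, Matrix.of_apply, map_sum, Finset.sum_mul]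
  refine Finset.sum_congr rfl fun l _ => ?_
  by_cases h1 : b l < b i
  · simp [hC h1]
  by_cases h2 : b j < b l
  · simp [hC' h2]
  have h3 : (b j - b i).toNat = (b l - b i).toNat + (b j - b l).toNat := by omega
  rw [h3, pow_add, map_mul]
  ring

theorem conjPow_one (b : Fin n → ℤ) : conjPow b (1 : Matrix (Fin n) (Fin n) F) = 1 := by
  ext1 i j
  by_cases h : i = j
  · subst h; simp [conjPow]
  · simp [conjPow, h]

/-- The triangular decomposition is applied after sorting the rows by `b`, and then carried back. A
triangular matrix in the sorted order is block triangular for `b`, ties in `b` imposing no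
condition. -/
theorem exists_blockTriangular_perm (b : Fin n → ℤ) {A : Matrix (Fin n) (Fin n) F}
    (hA : IsUnit A.det) (Z : Finset (Fin n)) :
    ∃ (C C' : Matrix (Fin n) (Fin n) F) (ρ : Equiv.Perm (Fin n)), C.BlockTriangular b ∧
      C'.BlockTriangular b ∧ C * C' = 1 ∧ ∀ i j, i ∉ Z → j ∈ Z → (C' * A) (ρ i) j = 0 := by
  let τ := Tuple.sort b
  have hτ : Monotone (b ∘ τ) := Tuple.monotone_sort b
  have hA' : IsUnit (A.submatrix τ id).det := by
    have h := Matrix.det_permute τ A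
    rw [h]
    exact (((Equiv.Perm.sign τ).isUnit.map (Int.castRingHom F))).mul hA
  obtain ⟨C, ρ, hC, hdet, h⟩ := exists_triangular_perm_inv_mul_apply_eq_zero hA' Z
  have hCu : IsUnit C.det := by rw [hdet]; exact isUnit_one
  have hinv := C.invertibleOfIsUnitDet hCu
  have hC' := Matrix.blockTriangular_inv_of_blockTriangular hC
  have htri : ∀ {B : Matrix (Fin n) (Fin n) F}, B.BlockTriangular id →
      (B.submatrix τ.symm τ.symm).BlockTriangular b := by
    intro B hB i j hij
    refine hB (not_le.1 fun hle => ?_)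
    have := hτ hle
    simp only [Function.comp_apply, id_eq, Equiv.apply_symm_apply] at this
    omega
  refine ⟨C.submatrix τ.symm τ.symm, C⁻¹.submatrix τ.symm τ.symm, ρ.trans τ, htri hC, htri hC',
    ?_, fun i j hi hj => ?_⟩
  · rw [Matrix.submatrix_mul_equiv, Matrix.mul_nonsing_inv _ hCu, Matrix.submatrix_one_equiv]
  · rw [← h i j hi hj, Matrix.mul_apply, Matrix.mul_apply, ← Equiv.sum_comp τ]
    simp

/-- The inductive step. Write `H` $=CD$, where the value of `D` at the point vanishes in the rows
$\rho(i)$ with $\varepsilon_i=1$ and the columns with $\varepsilon_j=0$. These are the only entries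
that get divided by $w$ when $w^\varepsilon$ is moved to the left of `D`, so integrality survives,
while $C$ passes to the left of $w^b$ as a polynomial in $1/w$. -/
theorem diagPow_mul_mul_diagPow (φ : F →+* K) {O : Subring K} {w : Kˣ}
    (hw : (w : K) ∈ O) (hφ : ∀ c, φ c ∈ O) (ev : O →+* F) (hev : ∀ c, ev ⟨φ c, hφ c⟩ = c)
    (hker : ∀ f : O, ev f = 0 → ∃ g ∈ O, (f : K) = w * g)
    {H : Matrix (Fin n) (Fin n) K} (hH : IsInvertibleOver O H) (b : Fin n → ℤ)
    {ε : Fin n → ℤ} (hε : ∀ i, ε i = 0 ∨ ε i = 1) :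
    ∃ (Q Q' : Matrix (Fin n) (Fin n) (Polynomial F)) (ρ : Equiv.Perm (Fin n))
      (H' : Matrix (Fin n) (Fin n) K), Q * Q' = 1 ∧ IsInvertibleOver O H' ∧
      diagPow w b * H * diagPow w ε =
        evalInv φ w Q * diagPow w (fun i => b i + ε (ρ i)) * H' := by
  obtain ⟨hHO, d, hd, hHd⟩ := hH
  let L : Matrix (Fin n) (Fin n) O := fun i j => ⟨H i j, hHO i j⟩
  have hL : (L.det : K) = H.det := RingHom.map_det O.subtype L
  have hA : IsUnit (L.map ev).det := by
    have h1 : L.det * ⟨d, hd⟩ = 1 := Subtype.ext (by simpa [hL] using hHd)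
    have h2 : (L.map ev).det = ev L.det := (RingHom.map_det ev L).symm
    exact IsUnit.of_mul_eq_one (ev ⟨d, hd⟩) (by rw [h2, ← map_mul, h1, map_one])
  obtain ⟨C, C', ρ, hC, hC', hCC', hz⟩ :=
    exists_blockTriangular_perm b hA (Finset.univ.filter fun i => ε i = 0)
  have hCC'φ : C.map φ * C'.map φ = 1 := by
    rw [← Matrix.map_mul, hCC']
    exact Matrix.map_one _ (map_zero _) (map_one _)
  -- `D` is integral, and so is its conjugate by `w ^ ε`.
  let D : Matrix (Fin n) (Fin n) K := C'.map φ * H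
  have hDO : ∀ i j, D i j ∈ O := mul_mem_subring (fun i j => hφ _) hHO
  have hDw : ∀ i j, ε i = 1 → ε j = 0 → ∃ g ∈ O, D (ρ i) j = w * g := by
    intro i j hi hj
    refine hker ⟨_, hDO (ρ i) j⟩ ?_
    -- Evaluating this sum gives the entry $(\rho(i),j)$ of `C'` times the value of `H`, which is
    -- zero by the choice of `ρ`; `hker` then makes the entry of `D` divisible by `w`.
    have h1 : (⟨D (ρ i) j, hDO (ρ i) j⟩ : O) = ∑ l, ⟨φ (C' (ρ i) l), hφ _⟩ * L l j := by
      apply Subtype.ext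
      simp [D, L, Matrix.mul_apply]
    rw [h1, map_sum]
    have h2 := hz i j (by simp [hi]) (by simp [hj])
    rw [Matrix.mul_apply] at h2
    simpa [hev] using h2
  let N : Matrix (Fin n) (Fin n) K :=
    diagPow w (-(ε ∘ ρ.symm)) * D * diagPow w ε
  have hN : ∀ i j, N i j = ((w ^ (ε j - ε (ρ.symm i)) : Kˣ) : K) * D i j := by
    intro i j
    simp only [N, diagPow]
    rw [Matrix.mul_diagonal, Matrix.diagonal_mul, sub_eq_add_neg, zpow_add, Units.val_mul]
    simp only [Pi.neg_apply, Function.comp_apply]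
    ring
  have hNO : ∀ i j, N i j ∈ O := by
    intro i j
    rw [hN]
    rcases hε (ρ.symm i) with hi | hi <;> rcases hε j with hj | hj
    · simpa [hi, hj] using hDO i j
    · simpa [hi, hj] using O.mul_mem hw (hDO i j)
    · obtain ⟨g, hg, hgD⟩ := hDw (ρ.symm i) j hi hj
      rw [ρ.apply_symm_apply] at hgD
      simpa [hi, hj, hgD] using hg
    · simpa [hi, hj] using hDO i j
  have hdetpow : ∀ e : Fin n → ℤ, (diagPow w e).det = ((w ^ ∑ i, e i : Kˣ) : K) := by
    intro e
    rw [diagPow, Matrix.det_diagonal]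
    have : w ^ ∑ i, e i = ∏ i, w ^ e i := by
      induction (Finset.univ : Finset (Fin n)) using Finset.induction_on with
      | empty => simp
      | insert a s ha ih => rw [Finset.sum_insert ha, Finset.prod_insert ha, zpow_add, ih]
    rw [this, Units.coe_prod]
  -- The two diagonal factors have inverse determinants, because a permutation does not change
  -- $\sum_i\varepsilon_i$. So `N` is invertible over `O` and not merely integral.
  have hNdet : N.det = (C'.map φ).det * H.det := by
    simp only [N, D, Matrix.det_mul, hdetpow]
    have h1 : ∑ i, (-(ε ∘ ρ.symm)) i = -∑ i, ε i := by
      simp only [Pi.neg_apply, Function.comp_apply, Finset.sum_neg_distrib]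
      rw [Equiv.sum_comp ρ.symm ε]
    rw [h1, mul_right_comm, ← Units.val_mul, ← zpow_add, neg_add_cancel]
    simp
  refine ⟨conjPow b C, conjPow b C', ρ.symm, N, ?_, ⟨hNO, d * (C.map φ).det,
    O.mul_mem hd (det_mem_subring fun i j => hφ _), ?_⟩, ?_⟩
  · rw [conjPow_mul_conjPow hC hC', hCC', conjPow_one]
  · have h1 : (C.map φ).det * (C'.map φ).det = 1 := by
      rw [← Matrix.det_mul, hCC'φ, Matrix.det_one]
    rw [hNdet]
    linear_combination H.det * d * h1 + hHd
  · have h1 : diagPow w (fun i => b i + ε (ρ.symm i)) = diagPow w b * diagPow w (ε ∘ ρ.symm) := by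
      rw [diagPow_mul]; rfl
    have h2 : diagPow w (ε ∘ ρ.symm) * N = D * diagPow w ε := by
      simp only [N]
      rw [← Matrix.mul_assoc, ← Matrix.mul_assoc, diagPow_mul, add_neg_cancel]
      simp [diagPow]
    rw [h1, Matrix.mul_assoc _ _ N, Matrix.mul_assoc _ _ N, h2, ← Matrix.mul_assoc,
      evalInv_conjPow φ w hC]
    simp only [D]
    rw [Matrix.mul_assoc, Matrix.mul_assoc, Matrix.mul_assoc, ← Matrix.mul_assoc (C.map φ),
      hCC'φ, Matrix.one_mul]

/-- A factorisation of Birkhoff type at one point, with control of the exponents. -/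
theorem exists_factorisation (φ : F →+* K) {O : Subring K} {w : Kˣ}
    (hw : (w : K) ∈ O) (hφ : ∀ c, φ c ∈ O) (ev : O →+* F) (hev : ∀ c, ev ⟨φ c, hφ c⟩ = c)
    (hker : ∀ f : O, ev f = 0 → ∃ g ∈ O, (f : K) = w * g)
    {G : Matrix (Fin n) (Fin n) K} (hG : IsInvertibleOver O G) (c : ℤ)
    {ε : ℕ → Fin n → ℤ} (hε : ∀ j i, ε j i = 0 ∨ ε j i = 1) (d : ℕ) :
    ∃ (P P' : Matrix (Fin n) (Fin n) (Polynomial F)) (ρ : ℕ → Equiv.Perm (Fin n))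
      (H : Matrix (Fin n) (Fin n) K), P * P' = 1 ∧ IsInvertibleOver O H ∧
      G * diagPow w (fun i => c + ∑ l ∈ Finset.Icc 1 d, ε l i) =
        evalInv φ w P * diagPow w (fun i => c + ∑ l ∈ Finset.Icc 1 d, ε l (ρ l i)) * H := by
  induction d with
  | zero =>
    refine ⟨1, 1, fun _ => 1, G, Matrix.mul_one 1, hG, ?_⟩
    rw [evalInv_one, Matrix.one_mul]
    ext i j
    simp [diagPow, mul_comm]
  | succ d ih =>
    obtain ⟨P, P', ρ, H, hP, hH, h⟩ := ih
    obtain ⟨Q, Q', τ, H', hQ, hH', h'⟩ := diagPow_mul_mul_diagPow φ hw hφ ev hev hker hH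
      (fun i => c + ∑ l ∈ Finset.Icc 1 d, ε l (ρ l i)) (hε (d + 1))
    -- The earlier permutations are kept: each step prescribes only the permutation of its own term.
    refine ⟨P * Q, Q' * P', Function.update ρ (d + 1) τ, H', ?_, hH', ?_⟩
    · rw [Matrix.mul_assoc, ← Matrix.mul_assoc Q, hQ, Matrix.one_mul, hP]
    · have h1 : (fun i => c + ∑ l ∈ Finset.Icc 1 (d + 1), ε l i) =
          (fun i => c + ∑ l ∈ Finset.Icc 1 d, ε l i) + ε (d + 1) := by
        funext i
        rw [Finset.sum_Icc_succ_top (by omega), ← add_assoc]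
        rfl
      have h2 : (fun i => c + ∑ l ∈ Finset.Icc 1 (d + 1),
            ε l (Function.update ρ (d + 1) τ l i)) =
          fun i => c + ∑ l ∈ Finset.Icc 1 d, ε l (ρ l i) + ε (d + 1) (τ i) := by
        funext i
        rw [Finset.sum_Icc_succ_top (by omega), ← add_assoc, Function.update_self]
        congr 2
        refine Finset.sum_congr rfl fun l hl => ?_
        rw [Function.update_of_ne (by have := Finset.mem_Icc.1 hl; omega)]
      rw [h1, h2, ← diagPow_mul, ← Matrix.mul_assoc, h, evalInv_mul,
        Matrix.mul_assoc (evalInv φ w P), Matrix.mul_assoc (evalInv φ w P), h']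
      simp only [Matrix.mul_assoc]

/-- Since `H` preserves $O^n$, the lattice $Gw^kO^n$ equals $P(1/w)w^bO^n$, and membership is tested
by applying $w^{-b}P(1/w)^{-1}$. -/
theorem mem_lattice_iff_of_factorisation (φ : F →+* K) {O : Subring K} {w : Kˣ}
    {G H : Matrix (Fin n) (Fin n) K} (hH : IsInvertibleOver O H) {k b : Fin n → ℤ}
    {P P' : Matrix (Fin n) (Fin n) (Polynomial F)} (hP : P * P' = 1)
    (h : G * diagPow w k = evalInv φ w P * diagPow w b * H) (t : Fin n → K) :
    (∃ r : Fin n → K, (∀ i, r i ∈ O) ∧ t = (G * diagPow w k).mulVec r) ↔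
      ∀ i, (diagPow w (-b) * evalInv φ w P').mulVec t i ∈ O := by
  obtain ⟨H', hH'O, hHH', hH'H⟩ := hH.exists_inverse
  have hP' : evalInv φ w P' * evalInv φ w P = 1 := by
    rw [← evalInv_mul, mul_eq_one_comm.1 hP, evalInv_one]
  have hP'' : evalInv φ w P * evalInv φ w P' = 1 := by
    rw [← evalInv_mul, hP, evalInv_one]
  have hb : diagPow w b * diagPow w (-b) = 1 := by
    rw [diagPow_mul, add_neg_cancel]
    simp [diagPow]
  rw [h]
  constructor
  · rintro ⟨r, hr, rfl⟩ i
    have h1 : diagPow w (-b) * evalInv φ w P' * (evalInv φ w P * diagPow w b * H) = H := by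
      calc _ = diagPow w (-b) * (evalInv φ w P' * evalInv φ w P) * diagPow w b * H := by
            simp only [Matrix.mul_assoc]
        _ = H := by rw [hP', Matrix.mul_one, diagPow_neg_mul, Matrix.one_mul]
    rw [Matrix.mulVec_mulVec, h1]
    exact mulVec_mem_subring hH.1 hr i
  · intro ht
    refine ⟨H'.mulVec ((diagPow w (-b) * evalInv φ w P').mulVec t),
      mulVec_mem_subring hH'O ht, ?_⟩
    have h1 : evalInv φ w P * diagPow w b * H * H' * (diagPow w (-b) * evalInv φ w P') = 1 := by
      calc _ = evalInv φ w P * (diagPow w b * (H * H') * diagPow w (-b)) * evalInv φ w P' := by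
            simp only [Matrix.mul_assoc]
        _ = 1 := by rw [hHH', Matrix.mul_one, hb, Matrix.mul_one, hP'']
    rw [Matrix.mulVec_mulVec, Matrix.mulVec_mulVec, h1, Matrix.one_mulVec]

theorem elementarySplitting_eq_zero_or_one (k : Fin n → ℤ) (j : ℕ) (i : Fin n) :
    elementarySplitting k j i = 0 ∨ elementarySplitting k j i = 1 := by
  unfold elementarySplitting
  omega

/-- The sum telescopes: its first $d$ terms add up to the truncation at $d$, which is the whole of
$k-\min k$ once $d$ reaches the maximum. -/
theorem add_sum_elementarySplitting (k : Fin n → ℤ) (i : Fin n) :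
    (⨅ j, k j) + ∑ l ∈ Finset.Icc 1 (splittingLength k), elementarySplitting k l i = k i := by
  have h0 : 0 ≤ normalised k i :=
    sub_nonneg.2 (ciInf_le (Set.finite_range k).bddBelow i)
  have h1 : normalised k i ≤ splittingLength k :=
    (le_ciSup (Set.finite_range (normalised k)).bddAbove i).trans (Int.self_le_toNat _)
  have h2 : ∀ d : ℕ, ∑ l ∈ Finset.Icc 1 d, elementarySplitting k l i = min (normalised k i) d := by
    intro d
    induction d with
    | zero => simp [h0]
    | succ d ih =>
      rw [Finset.sum_Icc_succ_top (by omega), ih, elementarySplitting]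
      push_cast
      rw [add_sub_cancel_right]
      ring
  rw [h2, min_eq_left h1, normalised]
  ring

theorem exists_lattice_criterion (φ : F →+* K) {O : Subring K} {w : Kˣ}
    (hw : (w : K) ∈ O) (hφ : ∀ c, φ c ∈ O) (ev : O →+* F) (hev : ∀ c, ev ⟨φ c, hφ c⟩ = c)
    (hker : ∀ f : O, ev f = 0 → ∃ g ∈ O, (f : K) = w * g)
    {G : Matrix (Fin n) (Fin n) K} (hG : IsInvertibleOver O G) (k : Fin n → ℤ) :
    ∃ (P P' : Matrix (Fin n) (Fin n) (Polynomial F)) (b : Fin n → ℤ)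
      (ρ : ℕ → Equiv.Perm (Fin n)), P * P' = 1 ∧ Monotone b ∧
      (∀ i, b i = (⨅ j, k j) +
        ∑ l ∈ Finset.Icc 1 (splittingLength k), elementarySplitting k l (ρ l i)) ∧
      ∀ t : Fin n → K, (∃ r : Fin n → K, (∀ i, r i ∈ O) ∧ t = (G * diagPow w k).mulVec r) ↔
        ∀ i, (diagPow w (-b) * evalInv φ w P').mulVec t i ∈ O := by
  obtain ⟨P, P', ρ, H, hP, hH, h⟩ := exists_factorisation φ hw hφ ev hev hker hG (⨅ j, k j)
    (elementarySplitting_eq_zero_or_one k) (splittingLength k)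
  simp only [add_sum_elementarySplitting] at h
  let b : Fin n → ℤ := fun i => (⨅ j, k j) +
    ∑ l ∈ Finset.Icc 1 (splittingLength k), elementarySplitting k l (ρ l i)
  -- Sorting `b` will make $m-b$ a type. The sorting permutation is absorbed into the columns of `P`
  -- and into every `ρ l`.
  let τ := Tuple.sort b
  refine ⟨P.submatrix id τ, P'.submatrix τ id, b ∘ τ, fun l => τ.trans (ρ l), ?_,
    Tuple.monotone_sort b, fun i => rfl, fun t => ?_⟩
  · rw [Matrix.submatrix_mul_equiv, hP, Matrix.submatrix_id_id]
  · rw [mem_lattice_iff_of_factorisation φ hH hP h]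
    have h1 : diagPow w (-(b ∘ τ)) * evalInv φ w (P'.submatrix τ id) =
        (diagPow w (-b) * evalInv φ w P').submatrix τ id := by
      ext i j
      simp only [diagPow, Matrix.diagonal_mul, Matrix.submatrix_apply]
      rfl
    rw [h1]
    exact (Equiv.forall_congr_left τ).trans (forall_congr' fun i => by
      simp [Matrix.mulVec, dotProduct, b]) |>.symm

end LocalFactorisation

/-! ### Holomorphic functions in charts and the local coordinate -/

section HolomorphicFunctions

theorem holAt_iff_analyticAt {f : RiemannSphere → ℂ} {p : RiemannSphere} :
    HolAt f p ↔ AnalyticAt ℂ (f ∘ (chartAt ℂ p).symm) (chartAt ℂ p p) := by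
  rw [HolAt, contMDiffAt_iff_source]
  simp only [mfld_simps, contMDiffWithinAt_univ, contMDiffAt_iff_contDiffAt]
  exact ⟨ContDiffAt.analyticAt, AnalyticAt.contDiffAt⟩

theorem holAt_coe_iff {f : RiemannSphere → ℂ} {z : ℂ} :
    HolAt f z ↔ AnalyticAt ℂ (fun y : ℂ => f y) z := by
  rw [holAt_iff_analyticAt]
  change AnalyticAt ℂ (f ∘ affineChart.symm) (affineChart z) ↔ _
  rw [affineChart_coe]
  rfl

theorem holAt_infty_iff {f : RiemannSphere → ℂ} :
    HolAt f OnePoint.infty ↔ AnalyticAt ℂ (fun y : ℂ => f (inversion y)) 0 := by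
  rw [holAt_iff_analyticAt]
  change AnalyticAt ℂ (f ∘ inftyChart.symm) (inftyChart OnePoint.infty) ↔ _
  rw [inftyChart_infty]
  rfl

theorem HolAt.continuousAt {f : RiemannSphere → ℂ} {p : RiemannSphere} (hf : HolAt f p) :
    ContinuousAt f p := ContMDiffAt.continuousAt hf

theorem HolAt.eventually {f : RiemannSphere → ℂ} {p : RiemannSphere} (hf : HolAt f p) :
    ∀ᶠ q in 𝓝 p, HolAt f q :=
  (contMDiffAt_iff_contMDiffAt_nhds (by simp)).1 hf

theorem HolAt.mul {f g : RiemannSphere → ℂ} {p : RiemannSphere} (hf : HolAt f p)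
    (hg : HolAt g p) : HolAt (fun q => f q * g q) p := ContMDiffAt.mul hf hg

theorem HolAt.zpow {f : RiemannSphere → ℂ} {p : RiemannSphere} (hf : HolAt f p)
    (h : f p ≠ 0) (k : ℤ) : HolAt (fun q => f q ^ k) p := by
  rw [holAt_iff_analyticAt] at hf ⊢
  refine hf.fun_zpow (n := k) ?_
  rwa [Function.comp_apply, (chartAt ℂ p).left_inv (mem_chart_source ℂ p)]

theorem HolAt.sum {ι : Type*} {s : Finset ι} {f : ι → RiemannSphere → ℂ} {p : RiemannSphere}
    (hf : ∀ i ∈ s, HolAt (f i) p) : HolAt (fun q => ∑ i ∈ s, f i q) p :=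
  contMDiffAt_finsetSum hf

theorem HolAt.polynomial_eval {f : RiemannSphere → ℂ} {p : RiemannSphere} (hf : HolAt f p)
    (P : Polynomial ℂ) : HolAt (fun q => P.eval (f q)) p := by
  rw [holAt_iff_analyticAt] at hf ⊢
  exact (AnalyticAt.aeval_polynomial hf P).congr (Filter.Eventually.of_forall fun q => by simp)

theorem holAt_const (c : ℂ) (p : RiemannSphere) : HolAt (fun _ => c) p := contMDiffAt_const

/-- The local coordinate centred at `x`. -/
def localCoord (x q : RiemannSphere) : ℂ := chartAt ℂ x q - chartAt ℂ x x

theorem holAt_localCoord (x : RiemannSphere) : HolAt (localCoord x) x := by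
  rw [holAt_iff_analyticAt]
  have h : AnalyticAt ℂ (fun z : ℂ => z - chartAt ℂ x x) (chartAt ℂ x x) := by fun_prop
  refine h.congr ?_
  filter_upwards [(chartAt ℂ x).open_target.mem_nhds (mem_chart_target ℂ x)] with z hz
  simp [localCoord, (chartAt ℂ x).right_inv hz]

theorem eventually_localCoord_ne_zero (x : RiemannSphere) :
    ∀ᶠ q in 𝓝[≠] x, localCoord x q ≠ 0 := by
  filter_upwards [self_mem_nhdsWithin, mem_nhdsWithin_of_mem_nhds
    ((chartAt ℂ x).open_source.mem_nhds (mem_chart_source ℂ x))] with q hq hq' h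
  exact hq ((chartAt ℂ x).injOn hq' (mem_chart_source ℂ x) (sub_eq_zero.1 h))

theorem eventually_holAt_localCoord_zpow (x : RiemannSphere) (k : ℤ) :
    ∀ᶠ q in 𝓝[≠] x, HolAt (fun p => localCoord x p ^ k) q := by
  filter_upwards [eventually_localCoord_ne_zero x,
    (holAt_localCoord x).eventually.filter_mono nhdsWithin_le_nhds] with q h1 h2
  exact h2.zpow h1 k

/-- The quotient is the divided difference `dslope` in the chart, which is analytic. This makes the
local coordinate generate the kernel of evaluation, as the factorisation requires. -/
theorem HolAt.exists_eq_localCoord_mul {f : RiemannSphere → ℂ} {x : RiemannSphere}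
    (hf : HolAt f x) (h0 : f x = 0) :
    ∃ g, HolAt g x ∧ ∀ᶠ q in 𝓝 x, f q = localCoord x q * g q := by
  have hx := (chartAt ℂ x).left_inv (mem_chart_source ℂ x)
  rw [holAt_iff_analyticAt] at hf
  obtain ⟨P, hP⟩ := hf
  refine ⟨fun q => dslope (f ∘ (chartAt ℂ x).symm) (chartAt ℂ x x) (chartAt ℂ x q), ?_, ?_⟩
  · rw [holAt_iff_analyticAt]
    refine hP.has_fpower_series_dslope_fslope.analyticAt.congr ?_
    filter_upwards [(chartAt ℂ x).open_target.mem_nhds (mem_chart_target ℂ x)] with z hz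
    simp [(chartAt ℂ x).right_inv hz]
  · filter_upwards [(chartAt ℂ x).open_source.mem_nhds (mem_chart_source ℂ x)] with q hq
    have h := sub_smul_dslope (f ∘ (chartAt ℂ x).symm) (chartAt ℂ x x) (chartAt ℂ x q)
    rw [smul_eq_mul, Function.comp_apply, Function.comp_apply, hx, h0, sub_zero,
      (chartAt ℂ x).left_inv hq] at h
    exact h.symm

theorem HolAt.eq_of_eventually {f g : RiemannSphere → ℂ} {x : RiemannSphere} (hf : HolAt f x)
    (hg : HolAt g x) (h : ∀ᶠ q in 𝓝[≠] x, f q = g q) : f x = g x := by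
  have h1 : Filter.Tendsto f (𝓝[≠] x) (𝓝 (f x)) := hf.continuousAt.mono_left nhdsWithin_le_nhds
  have h2 : Filter.Tendsto g (𝓝[≠] x) (𝓝 (g x)) := hg.continuousAt.mono_left nhdsWithin_le_nhds
  exact tendsto_nhds_unique h1 (h2.congr' (h.mono fun q hq => hq.symm))

end HolomorphicFunctions

/-! ### The ring of germs as an instance of the abstract setting -/

section Germs

variable (x : RiemannSphere)

theorem mem_holGerm_iff {f : RiemannSphere → ℂ} :
    (f : FunGerm x) ∈ holGerm x ↔ ∃ g, HolAt g x ∧ ∀ᶠ q in 𝓝[≠] x, f q = g q :=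
  exists_congr fun _ => and_congr_right fun _ => Filter.Germ.coe_eq

/-- The germ of the local coordinate, as a unit. -/
def coordUnit : (FunGerm x)ˣ where
  val := (localCoord x : FunGerm x)
  inv := ((fun q => (localCoord x q)⁻¹ : RiemannSphere → ℂ) : FunGerm x)
  val_inv := Filter.Germ.coe_eq.2 <| by
    filter_upwards [eventually_localCoord_ne_zero x] with q hq
    exact mul_inv_cancel₀ hq
  inv_val := Filter.Germ.coe_eq.2 <| by
    filter_upwards [eventually_localCoord_ne_zero x] with q hq
    exact inv_mul_cancel₀ hq

theorem coe_coordUnit_zpow (k : ℤ) :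
    ((coordUnit x ^ k : (FunGerm x)ˣ) : FunGerm x) = coordPow x k := by
  have hnat : ∀ m : ℕ, ((localCoord x : FunGerm x)) ^ m =
      ((fun q => localCoord x q ^ m : RiemannSphere → ℂ) : FunGerm x) := fun m => rfl
  have hnat' : ∀ m : ℕ, ((fun q => (localCoord x q)⁻¹ : RiemannSphere → ℂ) : FunGerm x) ^ m =
      ((fun q => (localCoord x q)⁻¹ ^ m : RiemannSphere → ℂ) : FunGerm x) := fun m => rfl
  obtain ⟨m, rfl | rfl⟩ := k.eq_nat_or_neg
  · rw [zpow_natCast, Units.val_pow_eq_pow_val]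
    refine (hnat m).trans ?_
    simp only [coordPow, zpow_natCast]
    rfl
  · rw [zpow_neg, zpow_natCast, ← inv_pow, Units.val_pow_eq_pow_val]
    refine (hnat' m).trans ?_
    simp only [coordPow, zpow_neg, zpow_natCast, inv_pow]
    rfl

theorem coordUnit_mem_holGerm : (coordUnit x : FunGerm x) ∈ holGerm x :=
  ⟨localCoord x, holAt_localCoord x, rfl⟩

/-- The germs of constant functions. -/
def constGerm : ℂ →+* FunGerm x :=
  (Filter.Germ.coeRingHom (𝓝[≠] x)).comp (Pi.constRingHom RiemannSphere ℂ)

theorem constGerm_mem_holGerm (c : ℂ) : constGerm x c ∈ holGerm x :=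
  ⟨fun _ => c, holAt_const c x, rfl⟩

/-- The value at `x` of a germ of holomorphic functions. -/
def germValue : holGerm x →+* ℂ :=
  -- A punctured germ has a value at `x` because its holomorphic representatives are continuous and
  -- agree off `x`; the chosen representative therefore does not matter.
  have key : ∀ (φ : holGerm x) (f : RiemannSphere → ℂ), HolAt f x → φ.1 = (f : FunGerm x) →
      φ.2.choose x = f x := fun φ f hf h =>
    φ.2.choose_spec.1.eq_of_eventually hf (Filter.Germ.coe_eq.1 (φ.2.choose_spec.2.symm.trans h))
  { toFun := fun φ => φ.2.choose x
    map_one' := key 1 1 (holAt_const 1 x) rfl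
    map_zero' := key 0 0 (holAt_const 0 x) rfl
    map_mul' := fun φ ψ => by
      refine key (φ * ψ) _ (φ.2.choose_spec.1.mul ψ.2.choose_spec.1) ?_
      exact congrArg₂ (· * ·) φ.2.choose_spec.2 ψ.2.choose_spec.2
    map_add' := fun φ ψ => by
      refine key (φ + ψ) _ (ContMDiffAt.add φ.2.choose_spec.1 ψ.2.choose_spec.1) ?_
      exact congrArg₂ (· + ·) φ.2.choose_spec.2 ψ.2.choose_spec.2 }

variable {x}

theorem germValue_eq {φ : holGerm x} {f : RiemannSphere → ℂ} (hf : HolAt f x)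
    (h : φ.1 = (f : FunGerm x)) : germValue x φ = f x :=
  φ.2.choose_spec.1.eq_of_eventually hf (Filter.Germ.coe_eq.1 (φ.2.choose_spec.2.symm.trans h))

theorem germValue_const (c : ℂ) : germValue x ⟨constGerm x c, constGerm_mem_holGerm x c⟩ = c :=
  germValue_eq (holAt_const c x) rfl

theorem exists_eq_coordUnit_mul {φ : holGerm x} (h : germValue x φ = 0) :
    ∃ g ∈ holGerm x, (φ : FunGerm x) = coordUnit x * g := by
  obtain ⟨_, f, hf, rfl⟩ := φ
  rw [germValue_eq hf rfl] at h
  obtain ⟨g, hg, hfg⟩ := hf.exists_eq_localCoord_mul h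
  exact ⟨g, ⟨g, hg, rfl⟩, Filter.Germ.coe_eq.2 (hfg.filter_mono nhdsWithin_le_nhds)⟩

end Germs

/-! ### Local expressions of sections of $\mathcal O(a)$, and global sections adapted to a point -/

section Twists

/-- The local expression near `p` of a section of `𝒪(a)`. -/
def localTwist (p : RiemannSphere) (a : ℤ) (f : RiemannSphere → ℂ) : RiemannSphere → ℂ :=
  open Classical in if p = OnePoint.infty then inftyTwist a f else f

theorem localTwist_infty (a : ℤ) (f : RiemannSphere → ℂ) :
    localTwist OnePoint.infty a f = inftyTwist a f := if_pos rfl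

theorem localTwist_coe (z : ℂ) (a : ℤ) (f : RiemannSphere → ℂ) :
    localTwist z a f = f := if_neg (OnePoint.coe_ne_infty z)

theorem holTwistAt_iff {a : ℤ} {f : RiemannSphere → ℂ} {p : RiemannSphere} :
    HolTwistAt a f p ↔ HolAt (localTwist p a f) p := by
  induction p using OnePoint.rec with
  | infty => simp [HolTwistAt, localTwist_infty]
  | coe z => simp [HolTwistAt, localTwist_coe]

theorem eventually_ne_zero_nhds_infty :
    ∀ᶠ q : RiemannSphere in 𝓝 OnePoint.infty, q ≠ ((0 : ℂ) : RiemannSphere) :=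
  isOpen_ne.mem_nhds (OnePoint.infty_ne_coe 0)

/-- For $p=\infty$ the identity can fail at $z=0$, where $0^{-(a+b)}$ need not be $0^{-a}\,0^{-b}$
under the convention $0^{-1}=0$; hence it is stated near `p` only. -/
theorem localTwist_mul (p : RiemannSphere) (a b : ℤ) (f g : RiemannSphere → ℂ) :
    ∀ᶠ q in 𝓝 p, localTwist p (a + b) (fun r => f r * g r) q =
      localTwist p a f q * localTwist p b g q := by
  induction p using OnePoint.rec with
  | coe z => simp [localTwist_coe]
  | infty =>
    filter_upwards [eventually_ne_zero_nhds_infty] with q hq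
    simp only [localTwist_infty]
    induction q using OnePoint.rec with
    | infty => simp [inftyTwist]
    | coe z =>
      have hz : z ≠ 0 := fun h => hq (by rw [h])
      simp only [inftyTwist, OnePoint.elim_some]
      rw [neg_add, zpow_add₀ hz]
      ring

theorem localTwist_zpow (p : RiemannSphere) (a k : ℤ) (f : RiemannSphere → ℂ) :
    localTwist p (k * a) (fun r => f r ^ k) = fun q => localTwist p a f q ^ k := by
  funext q
  induction p using OnePoint.rec with
  | coe z => simp [localTwist_coe]
  | infty =>
    simp only [localTwist_infty]
    induction q using OnePoint.rec with
    | infty => simp [inftyTwist]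
    | coe z =>
      simp only [inftyTwist, OnePoint.elim_some]
      rw [mul_zpow, ← zpow_mul, neg_mul, mul_comm a]

theorem localTwist_sum {ι : Type*} (s : Finset ι) (p : RiemannSphere) (a : ℤ)
    (f : ι → RiemannSphere → ℂ) :
    localTwist p a (fun q => ∑ i ∈ s, f i q) = fun q => ∑ i ∈ s, localTwist p a (f i) q := by
  funext q
  induction p using OnePoint.rec with
  | coe z => simp [localTwist_coe]
  | infty =>
    simp only [localTwist_infty]
    induction q using OnePoint.rec with
    | infty => simp [inftyTwist]
    | coe z => simp [inftyTwist, Finset.mul_sum]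

theorem localTwist_zero (p : RiemannSphere) (f : RiemannSphere → ℂ) : localTwist p 0 f = f := by
  funext q
  induction p using OnePoint.rec with
  | coe z => simp [localTwist_coe]
  | infty =>
    simp only [localTwist_infty]
    induction q using OnePoint.rec with
    | infty => simp [inftyTwist]
    | coe z => simp [inftyTwist]

theorem localTwist_congr {p : RiemannSphere} {l : Filter RiemannSphere} (a : ℤ)
    {f g : RiemannSphere → ℂ} (h : ∀ᶠ q in l, f q = g q) :
    ∀ᶠ q in l, localTwist p a f q = localTwist p a g q := by
  filter_upwards [h] with q hq
  induction p using OnePoint.rec with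
  | coe z => simpa [localTwist_coe] using hq
  | infty =>
    simp only [localTwist_infty]
    induction q using OnePoint.rec with
    | infty => simpa [inftyTwist] using hq
    | coe z => simp [inftyTwist, hq]

theorem HolTwistAt.mul_add {a b : ℤ} {f g : RiemannSphere → ℂ} {p : RiemannSphere}
    (hf : HolTwistAt a f p) (hg : HolTwistAt b g p) :
    HolTwistAt (a + b) (fun q => f q * g q) p := by
  rw [holTwistAt_iff] at *
  exact (hf.mul hg).congr (localTwist_mul p a b f g)

theorem HolTwistAt.sum {ι : Type*} {s : Finset ι} {a : ℤ} {f : ι → RiemannSphere → ℂ}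
    {p : RiemannSphere} (h : ∀ i ∈ s, HolTwistAt a (f i) p) :
    HolTwistAt a (fun q => ∑ i ∈ s, f i q) p := by
  rw [holTwistAt_iff, localTwist_sum]
  exact HolAt.sum fun i hi => holTwistAt_iff.1 (h i hi)

theorem HolAt.holTwistAt_zero {f : RiemannSphere → ℂ} {p : RiemannSphere} (h : HolAt f p) :
    HolTwistAt 0 f p := by
  rwa [holTwistAt_iff, localTwist_zero]

/-- A section of `𝒪(1)` that vanishes exactly at `x`. -/
def vanishingSection (x q : RiemannSphere) : ℂ :=
  x.elim (q.elim 0 fun _ => 1) fun c => q.elim 1 fun z => z - c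

/-- A meromorphic function whose only pole is a simple one at `x`. -/
def polarFunction (x q : RiemannSphere) : ℂ :=
  x.elim (q.elim 0 fun z => z) fun c => q.elim 0 fun z => (z - c)⁻¹

theorem holAt_localTwist_vanishingSection {x p : RiemannSphere} :
    HolAt (localTwist p 1 (vanishingSection x)) p := by
  induction p using OnePoint.rec with
  | coe z =>
    rw [localTwist_coe, holAt_coe_iff]
    induction x using OnePoint.rec with
    | coe c => exact analyticAt_id.sub analyticAt_const
    | infty => exact analyticAt_const
  | infty =>
    rw [localTwist_infty, holAt_infty_iff]
    induction x using OnePoint.rec with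
    | coe c =>
      have h : AnalyticAt ℂ (fun y : ℂ => 1 - c * y) 0 := by fun_prop
      refine h.congr (Filter.Eventually.of_forall fun y => ?_)
      by_cases hy : y = 0
      · simp [hy, inversion_zero, inftyTwist, vanishingSection]
      · simp only [inversion_coe hy, inftyTwist, vanishingSection, OnePoint.elim_some]
        rw [zpow_neg_one, inv_inv, mul_sub, mul_inv_cancel₀ hy, mul_comm]
    | infty =>
      refine analyticAt_id.congr (Filter.Eventually.of_forall fun y => ?_)
      by_cases hy : y = 0
      · simp [hy, inversion_zero, inftyTwist, vanishingSection]
      · simp [inversion_coe hy, inftyTwist, vanishingSection]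

theorem localTwist_vanishingSection_ne_zero {x p : RiemannSphere} (h : p ≠ x) :
    localTwist p 1 (vanishingSection x) p ≠ 0 := by
  induction p using OnePoint.rec with
  | coe z =>
    rw [localTwist_coe]
    induction x using OnePoint.rec with
    | coe c => exact sub_ne_zero.2 fun h' => h (by rw [h'])
    | infty => exact one_ne_zero
  | infty =>
    rw [localTwist_infty]
    induction x using OnePoint.rec with
    | coe c => exact one_ne_zero
    | infty => exact absurd rfl h

theorem vanishingSection_ne_zero {x p : RiemannSphere} (h : p ≠ x) : vanishingSection x p ≠ 0 := by
  induction p using OnePoint.rec with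
  | coe z =>
    induction x using OnePoint.rec with
    | coe c => exact sub_ne_zero.2 fun h' => h (by rw [h'])
    | infty => exact one_ne_zero
  | infty =>
    induction x using OnePoint.rec with
    | coe c => exact one_ne_zero
    | infty => exact absurd rfl h

theorem holTwistAt_vanishingSection_zpow {x p : RiemannSphere} (h : p ≠ x) (k : ℤ) :
    HolTwistAt k (fun q => vanishingSection x q ^ k) p := by
  have h1 := holAt_localTwist_vanishingSection.zpow (localTwist_vanishingSection_ne_zero h) k
  rwa [← localTwist_zpow, mul_one, ← holTwistAt_iff] at h1

/-- The section is normalised to coincide with the chart coordinate, with no unit factor. Its powers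
therefore realise $w^{b}$ globally, at the cost of shifting the degree by $b$. -/
theorem eventually_localTwist_vanishingSection (x : RiemannSphere) :
    ∀ᶠ q in 𝓝[≠] x, localTwist x 1 (vanishingSection x) q = localCoord x q := by
  induction x using OnePoint.rec with
  | coe c =>
    have h2 : ∀ᶠ q : RiemannSphere in 𝓝 (c : RiemannSphere), q ≠ OnePoint.infty :=
      isOpen_ne.mem_nhds (OnePoint.coe_ne_infty c)
    filter_upwards [h2.filter_mono nhdsWithin_le_nhds] with q hq
    rw [localTwist_coe]
    change _ = affineChart q - affineChart c
    induction q using OnePoint.rec with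
    | infty => exact absurd rfl hq
    | coe z =>
      rw [affineChart_coe, affineChart_coe]
      rfl
  | infty =>
    filter_upwards [self_mem_nhdsWithin,
      eventually_ne_zero_nhds_infty.filter_mono nhdsWithin_le_nhds] with q hq hq0
    rw [localTwist_infty]
    change _ = inftyChart q - inftyChart OnePoint.infty
    induction q using OnePoint.rec with
    | infty => exact absurd rfl hq
    | coe z =>
      rw [inftyChart_infty, inftyChart_coe z fun h => hq0 (by rw [h])]
      simp [inftyTwist, vanishingSection]

theorem holAt_polarFunction {x p : RiemannSphere} (h : p ≠ x) : HolAt (polarFunction x) p := by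
  induction p using OnePoint.rec with
  | coe z =>
    rw [holAt_coe_iff]
    induction x using OnePoint.rec with
    | coe c =>
      exact (analyticAt_id.sub analyticAt_const).fun_inv (sub_ne_zero.2 fun h' => h (congrArg _ h'))
    | infty => exact analyticAt_id
  | infty =>
    rw [holAt_infty_iff]
    induction x using OnePoint.rec with
    | coe c =>
      have h : AnalyticAt ℂ (fun y : ℂ => y * (1 - c * y)⁻¹) 0 :=
        analyticAt_id.mul (AnalyticAt.fun_inv (by fun_prop) (by simp))
      refine h.congr (Filter.Eventually.of_forall fun y => ?_)
      by_cases hy : y = 0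
      · simp [hy, inversion_zero, polarFunction]
      · simp only [inversion_coe hy, polarFunction, OnePoint.elim_some]
        have h1 : y⁻¹ - c = y⁻¹ * (1 - c * y) := by field_simp
        rw [h1, mul_inv, inv_inv]
    | infty => exact absurd rfl h

/-- Thanks to this, a polynomial in $1/w$ extends from the germ at `x` to a function holomorphic on
all of $\mathbb P^1\setminus\{x\}$. -/
theorem coe_polarFunction (x : RiemannSphere) :
    (polarFunction x : FunGerm x) = (((coordUnit x)⁻¹ : (FunGerm x)ˣ) : FunGerm x) := by
  refine Filter.Germ.coe_eq.2 ?_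
  have h2 : ∀ᶠ q : RiemannSphere in 𝓝[≠] x, q ≠ OnePoint.infty := by
    induction x using OnePoint.rec with
    | coe c => exact mem_nhdsWithin_of_mem_nhds (isOpen_ne.mem_nhds (OnePoint.coe_ne_infty c))
    | infty => exact self_mem_nhdsWithin
  filter_upwards [eventually_localTwist_vanishingSection x, h2] with q hq hqx
  rw [← hq]
  induction q using OnePoint.rec with
  | infty => exact absurd rfl hqx
  | coe z =>
    induction x using OnePoint.rec with
    | coe c =>
      rw [localTwist_coe]
      rfl
    | infty =>
      rw [localTwist_infty]
      simp [inftyTwist, vanishingSection, polarFunction]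

end Twists

/-! ### Germs at $x$ of sections of $\mathcal O(a)$ -/

section TwistedGerms

/-- The punctured germ at `x` of the local expression of a section of `𝒪(a)`. -/
def twistGerm (x : RiemannSphere) (a : ℤ) (f : RiemannSphere → ℂ) : FunGerm x :=
  (localTwist x a f : FunGerm x)

variable {x : RiemannSphere} {a b : ℤ} {f g : RiemannSphere → ℂ}

theorem twistGerm_eq_iff : twistGerm x a f = twistGerm x a g ↔ ∀ᶠ q in 𝓝[≠] x, f q = g q := by
  rw [twistGerm, twistGerm, Filter.Germ.coe_eq]
  refine ⟨fun h => ?_, fun h => localTwist_congr a h⟩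
  induction x using OnePoint.rec with
  | coe z => rwa [localTwist_coe, localTwist_coe] at h
  | infty =>
    filter_upwards [h, eventually_ne_zero_nhds_infty.filter_mono nhdsWithin_le_nhds] with q hq hq0
    rw [localTwist_infty, localTwist_infty] at hq
    induction q using OnePoint.rec with
    | infty => exact hq
    | coe z =>
      have hz : z ≠ 0 := fun h => hq0 (by rw [h])
      exact mul_left_cancel₀ (zpow_ne_zero _ hz) hq

theorem twistGerm_mul :
    twistGerm x (a + b) (fun q => f q * g q) = twistGerm x a f * twistGerm x b g :=
  Filter.Germ.coe_eq.2 ((localTwist_mul x a b f g).filter_mono nhdsWithin_le_nhds)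

theorem twistGerm_zero : twistGerm x 0 f = (f : FunGerm x) := by
  rw [twistGerm, localTwist_zero]

theorem twistGerm_mul_left :
    twistGerm x a (fun q => f q * g q) = (f : FunGerm x) * twistGerm x a g := by
  rw [← twistGerm_zero, ← twistGerm_mul, zero_add]

theorem coe_sum_germ {ι : Type*} (s : Finset ι) (f : ι → RiemannSphere → ℂ) :
    ((fun q => ∑ i ∈ s, f i q : RiemannSphere → ℂ) : FunGerm x) =
      ∑ i ∈ s, (f i : FunGerm x) := by
  have h := map_sum (Filter.Germ.coeRingHom (𝓝[≠] x)) f s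
  rw [← Finset.sum_fn]
  exact h

theorem twistGerm_sum {ι : Type*} (s : Finset ι) (f : ι → RiemannSphere → ℂ) :
    twistGerm x a (fun q => ∑ i ∈ s, f i q) = ∑ i ∈ s, twistGerm x a (f i) := by
  rw [twistGerm, localTwist_sum, coe_sum_germ]
  rfl

theorem HolTwistAt.twistGerm_mem (h : HolTwistAt a f x) : twistGerm x a f ∈ holGerm x :=
  ⟨_, holTwistAt_iff.1 h, rfl⟩

/-- Only the value at `x` has to be corrected, since a punctured germ ignores it. In either
trivialisation the local expression at `x` is that value itself, so the value of the holomorphic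
representative is the right one. -/
theorem exists_holTwistAt_of_twistGerm_mem (h : twistGerm x a f ∈ holGerm x) :
    ∃ f' : RiemannSphere → ℂ, HolTwistAt a f' x ∧ ∀ q, q ≠ x → f' q = f q := by
  classical
  obtain ⟨g, hg, hfg⟩ := (mem_holGerm_iff x).1 h
  refine ⟨Function.update f x (g x), holTwistAt_iff.2 (hg.congr ?_),
    fun q hq => Function.update_of_ne hq _ _⟩
  rw [eventually_nhdsWithin_iff] at hfg
  filter_upwards [hfg] with q hq
  by_cases hqx : q = x
  · subst hqx
    induction q using OnePoint.rec with
    | coe z => simp [localTwist_coe]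
    | infty => simp [localTwist_infty, inftyTwist]
  · rw [← hq hqx]
    induction x using OnePoint.rec with
    | coe z => simp [localTwist_coe, hqx]
    | infty =>
      induction q using OnePoint.rec with
      | infty => exact absurd rfl hqx
      | coe z => simp [localTwist_infty, inftyTwist]

theorem HolTwistAt.eq_of_eventually (hf : HolTwistAt a f x) (hg : HolTwistAt a g x)
    (h : ∀ᶠ q in 𝓝[≠] x, f q = g q) : f x = g x := by
  have h1 := (holTwistAt_iff.1 hf).eq_of_eventually (holTwistAt_iff.1 hg) (localTwist_congr a h)
  induction x using OnePoint.rec with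
  | coe z => rwa [localTwist_coe, localTwist_coe] at h1
  | infty => rwa [localTwist_infty, localTwist_infty] at h1

theorem twistGerm_vanishingSection_zpow (k : ℤ) :
    twistGerm x k (fun q => vanishingSection x q ^ k) =
      ((coordUnit x ^ k : (FunGerm x)ˣ) : FunGerm x) := by
  have h := localTwist_zpow x 1 k (vanishingSection x)
  rw [mul_one] at h
  rw [coe_coordUnit_zpow, twistGerm, h]
  refine Filter.Germ.coe_eq.2 ?_
  filter_upwards [eventually_localTwist_vanishingSection x] with q hq
  rw [hq]
  rfl

theorem coe_eval_polarFunction (P : Polynomial ℂ) :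
    ((fun q => P.eval (polarFunction x q) : RiemannSphere → ℂ) : FunGerm x) =
      P.eval₂ (constGerm x) (((coordUnit x)⁻¹ : (FunGerm x)ˣ) : FunGerm x) := by
  have h := Polynomial.hom_eval₂ P (Pi.constRingHom RiemannSphere ℂ)
    (Filter.Germ.coeRingHom (𝓝[≠] x)) (polarFunction x)
  rw [← coe_polarFunction]
  refine Eq.trans ?_ h
  refine congrArg (fun f : RiemannSphere → ℂ => (f : FunGerm x)) (funext fun q => ?_)
  have h2 := Polynomial.hom_eval₂ P (Pi.constRingHom RiemannSphere ℂ)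
    (Pi.evalRingHom (fun _ => ℂ) q) (polarFunction x)
  exact h2.symm

end TwistedGerms

/-! ### The global matrices $w^{-b}P(1/w)$ and $P(1/w)w^b$ off $x$ -/

section TransitionMatrices

variable {n : ℕ} (x : RiemannSphere)

/-- The homomorphism `𝒪(m) ^ n → ⨁ 𝒪(m - b i)` off `x` with matrix `w ^ (-b) P(1 / w)`. -/
def poleMatrix (P : Matrix (Fin n) (Fin n) (Polynomial ℂ)) (b : Fin n → ℤ) (q : RiemannSphere) :
    Matrix (Fin n) (Fin n) ℂ :=
  Matrix.of fun i j => vanishingSection x q ^ (-b i) * (P i j).eval (polarFunction x q)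

/-- The homomorphism `⨁ 𝒪(m - b i) → 𝒪(m) ^ n` off `x` with matrix `P(1 / w) w ^ b`. -/
def poleMatrixInv (P : Matrix (Fin n) (Fin n) (Polynomial ℂ)) (b : Fin n → ℤ)
    (q : RiemannSphere) : Matrix (Fin n) (Fin n) ℂ :=
  Matrix.of fun i j => (P i j).eval (polarFunction x q) * vanishingSection x q ^ (b j)

variable {x} {P P' : Matrix (Fin n) (Fin n) (Polynomial ℂ)} {b : Fin n → ℤ}

theorem poleMatrixInv_mul_poleMatrix (hP : P * P' = 1) {q : RiemannSphere} (hq : q ≠ x) :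
    poleMatrixInv x P b q * poleMatrix x P' b q = 1 := by
  have h1 : (P * P').map (Polynomial.evalRingHom (polarFunction x q)) = 1 := by
    rw [hP]
    exact Matrix.map_one _ (map_zero _) (map_one _)
  rw [← h1, Matrix.map_mul]
  ext i j
  rw [Matrix.mul_apply, Matrix.mul_apply]
  refine Finset.sum_congr rfl fun l _ => ?_
  simp only [poleMatrix, poleMatrixInv, Matrix.of_apply, Matrix.map_apply,
    Polynomial.coe_evalRingHom]
  have h2 : vanishingSection x q ^ (b l) * vanishingSection x q ^ (-b l) = 1 := by
    rw [← zpow_add₀ (vanishingSection_ne_zero hq), add_neg_cancel, zpow_zero]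
  linear_combination (P i l).eval (polarFunction x q) * (P' l j).eval (polarFunction x q) * h2

theorem poleMatrix_mul_poleMatrixInv (hP : P * P' = 1) {q : RiemannSphere} (hq : q ≠ x) :
    poleMatrix x P' b q * poleMatrixInv x P b q = 1 :=
  mul_eq_one_comm.1 (poleMatrixInv_mul_poleMatrix hP hq)

variable {t : RiemannSphere → Fin n → ℂ} {m : ℤ} {p : RiemannSphere}

theorem holTwistAt_poleMatrix_mulVec (hp : p ≠ x) (ht : ∀ i, HolTwistAt m (fun q => t q i) p)
    (i : Fin n) : HolTwistAt (m - b i) (fun q => (poleMatrix x P b q).mulVec (t q) i) p := by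
  simp only [Matrix.mulVec, dotProduct]
  refine HolTwistAt.sum fun j _ => ?_
  rw [show m - b i = -b i + 0 + m by ring]
  exact ((holTwistAt_vanishingSection_zpow hp _).mul_add
    ((holAt_polarFunction hp).polynomial_eval (P i j)).holTwistAt_zero).mul_add (ht j)

theorem holTwistAt_poleMatrixInv_mulVec (hp : p ≠ x)
    (ht : ∀ i, HolTwistAt (m - b i) (fun q => t q i) p) (i : Fin n) :
    HolTwistAt m (fun q => (poleMatrixInv x P b q).mulVec (t q) i) p := by
  simp only [Matrix.mulVec, dotProduct]
  refine HolTwistAt.sum fun j _ => ?_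
  rw [show m = 0 + b j + (m - b j) by ring]
  exact (((holAt_polarFunction hp).polynomial_eval (P i j)).holTwistAt_zero.mul_add
    (holTwistAt_vanishingSection_zpow hp _)).mul_add (ht j)

/-- The link between the two sides of the proof: near `x` the global homomorphism acts by exactly
the matrix that tests membership in the lattice. -/
theorem twistGerm_poleMatrix_mulVec (t : RiemannSphere → Fin n → ℂ) (i : Fin n) :
    twistGerm x (m - b i) (fun q => (poleMatrix x P b q).mulVec (t q) i) =
      (diagPow (coordUnit x) (-b) * evalInv (constGerm x) (coordUnit x) P).mulVec
        (fun j => twistGerm x m fun q => t q j) i := by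
  have h : (fun q => (poleMatrix x P b q).mulVec (t q) i) =
      fun q => ∑ j, poleMatrix x P b q i j * t q j := rfl
  rw [h, twistGerm_sum, Matrix.mulVec, dotProduct]
  refine Finset.sum_congr rfl fun j _ => ?_
  rw [show m - b i = -b i + m by ring, twistGerm_mul, diagPow, Matrix.diagonal_mul]
  congr 1
  have h2 : (fun q => poleMatrix x P b q i j) =
      fun q => vanishingSection x q ^ (-b i) * (P i j).eval (polarFunction x q) := rfl
  rw [h2]
  have h3 := twistGerm_mul (x := x) (a := -b i) (b := 0)
    (f := fun q => vanishingSection x q ^ (-b i)) (g := fun q => (P i j).eval (polarFunction x q))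
  rw [add_zero] at h3
  rw [h3, twistGerm_vanishingSection_zpow, twistGerm_zero, coe_eval_polarFunction]
  rfl

end TransitionMatrices

/-! ### Transport of linear relations by sheaf isomorphisms -/

section SheafIsomorphisms

theorem extendZero_coe_eventually {W : RiemannSphere → Type*}
    [∀ p, AddCommGroup (W p)] {U : Opens RiemannSphere} (s : ∀ p, W p) {p : RiemannSphere}
    (hp : p ∈ U) : ∀ᶠ q in 𝓝 p, extendZero U (fun r : U => s r) q = s q := by
  filter_upwards [U.2.mem_nhds hp] with q hq
  exact extendZero_of_mem _ hq

variable {W W' W'' : RiemannSphere → Type*} [∀ p, AddCommGroup (W p)] [∀ p, Module ℂ (W p)]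
  [∀ p, AddCommGroup (W' p)] [∀ p, Module ℂ (W' p)]
  [∀ p, AddCommGroup (W'' p)] [∀ p, Module ℂ (W'' p)]
  {𝓕 : SectionSheaf W} {𝓖 : SectionSheaf W'} {𝓗 : SectionSheaf W''}

def SheafIso.symm (φ : SheafIso 𝓕 𝓖) : SheafIso 𝓖 𝓕 where
  equiv U := (φ.equiv U).symm
  naturality {U V} h s := by
    rw [LinearEquiv.symm_apply_eq, φ.naturality, LinearEquiv.apply_symm_apply]

def SheafIso.trans (φ : SheafIso 𝓕 𝓖) (ψ : SheafIso 𝓖 𝓗) : SheafIso 𝓕 𝓗 where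
  equiv U := (φ.equiv U).trans (ψ.equiv U)
  naturality h s := by
    rw [LinearEquiv.trans_apply, φ.naturality, ψ.naturality, LinearEquiv.trans_apply]

/-- The restriction to `U` of a function that is holomorphic at the points of `U`. -/
def holFunOf {U : Opens RiemannSphere} (f : RiemannSphere → ℂ) (hf : ∀ p ∈ U, HolAt f p) :
    holFun U :=
  ⟨fun p => f p, fun p hp => (hf p hp).congr (extendZero_coe_eventually (W := fun _ => ℂ) f hp)⟩

theorem SectionSheaf.res_eq_sum_iff {ι : Type*} [Fintype ι] {U V V' : Opens RiemannSphere}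
    (hV : U ≤ V) (hV' : U ≤ V') (s : 𝓕.sections V) (s' : ι → 𝓕.sections V')
    (c : ι → RiemannSphere → ℂ) (hc : ∀ i, ∀ p ∈ U, HolAt (c i) p) :
    𝓕.res hV s = ∑ i, holFunOf (c i) (hc i) • 𝓕.res hV' (s' i) ↔
      ∀ p ∈ U, extendZero V s.1 p = ∑ i, c i p • extendZero V' (s' i).1 p := by
  have hsum : ∀ p : U, (∑ i, holFunOf (c i) (hc i) • 𝓕.res hV' (s' i)).1 p =
      ∑ i, c i p • extendZero V' (s' i).1 p := by
    intro p
    rw [Submodule.coe_sum, Finset.sum_apply]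
    refine Finset.sum_congr rfl fun i _ => ?_
    rw [extendZero_of_mem _ (hV' p.2)]
    rfl
  rw [Subtype.ext_iff, funext_iff, Subtype.forall]
  refine forall₂_congr fun p hp => ?_
  rw [hsum ⟨p, hp⟩, extendZero_of_mem _ (hV hp)]
  rfl

/-- An isomorphism of sheaves respects linear relations with holomorphic coefficients. -/
theorem SheafIso.eq_sum_iff (φ : SheafIso 𝓕 𝓖) {ι : Type*} [Fintype ι]
    {U V V' : Opens RiemannSphere} (hV : U ≤ V) (hV' : U ≤ V') (s : 𝓕.sections V)
    (s' : ι → 𝓕.sections V') (c : ι → RiemannSphere → ℂ) (hc : ∀ i, ∀ p ∈ U, HolAt (c i) p) :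
    (∀ p ∈ U, extendZero V s.1 p = ∑ i, c i p • extendZero V' (s' i).1 p) ↔
      ∀ p ∈ U, extendZero V (φ.equiv V s).1 p =
        ∑ i, c i p • extendZero V' (φ.equiv V' (s' i)).1 p := by
  rw [← 𝓕.res_eq_sum_iff hV hV' s s' c hc, ← 𝓖.res_eq_sum_iff hV hV' _ _ c hc,
    ← (φ.equiv U).injective.eq_iff, map_sum]
  simp only [map_smul, φ.naturality]

/-- The same relation between germs off a point. -/
theorem SheafIso.eventually_eq_sum_iff (φ : SheafIso 𝓕 𝓖) {ι : Type*} [Fintype ι]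
    {x : RiemannSphere} {V V' : Opens RiemannSphere} (hV : (V : Set RiemannSphere) ∈ 𝓝[≠] x)
    (hV' : (V' : Set RiemannSphere) ∈ 𝓝[≠] x) (s : 𝓕.sections V)
    (s' : ι → 𝓕.sections V') (c : ι → RiemannSphere → ℂ)
    (hc : ∀ i, ∀ᶠ p in 𝓝[≠] x, HolAt (c i) p) :
    (∀ᶠ p in 𝓝[≠] x, extendZero V s.1 p = ∑ i, c i p • extendZero V' (s' i).1 p) ↔
      ∀ᶠ p in 𝓝[≠] x, extendZero V (φ.equiv V s).1 p =
        ∑ i, c i p • extendZero V' (φ.equiv V' (s' i)).1 p := by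
  -- The coefficients may have poles at `x`, so the relation is restricted to an open punctured
  -- neighbourhood on which all of them are holomorphic.
  have key : ∀ Q : RiemannSphere → Prop, (∀ᶠ p in 𝓝[≠] x, Q p) →
      ∃ U : Opens RiemannSphere, (U : Set RiemannSphere) ∈ 𝓝[≠] x ∧ U ≤ V ∧ U ≤ V' ∧
        (∀ i, ∀ p ∈ U, HolAt (c i) p) ∧ ∀ p ∈ U, Q p := by
    intro Q hQ
    have h := (((show ∀ᶠ p in 𝓝[≠] x, p ∈ V from hV).and
      (show ∀ᶠ p in 𝓝[≠] x, p ∈ V' from hV')).and (Filter.eventually_all.2 hc)).and hQ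
    obtain ⟨O, hO, hxO, hOsub⟩ := mem_nhdsWithin.1 h
    refine ⟨⟨O ∩ {x}ᶜ, hO.inter isOpen_compl_singleton⟩,
      Filter.inter_mem (mem_nhdsWithin_of_mem_nhds (hO.mem_nhds hxO)) self_mem_nhdsWithin, fun p hp => (hOsub hp).1.1.1, fun p hp => (hOsub hp).1.1.2,
      fun i p hp => (hOsub hp).1.2 i, fun p hp => (hOsub hp).2⟩
  constructor
  · intro h
    obtain ⟨U, hU, h1, h2, h3, h4⟩ := key _ h
    filter_upwards [hU] with p hp
    exact (φ.eq_sum_iff h1 h2 s s' c h3).1 h4 p hp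
  · intro h
    obtain ⟨U, hU, h1, h2, h3, h4⟩ := key _ h
    filter_upwards [hU] with p hp
    exact (φ.eq_sum_iff h1 h2 s s' c h3).2 h4 p hp

/-- A linear bijective correspondence compatible with restriction is an isomorphism. -/
theorem nonempty_sheafIso_of_correspondence
    (r : ∀ U : Opens RiemannSphere, 𝓕.sections U → 𝓖.sections U → Prop)
    (hadd : ∀ U s s' t t', r U s t → r U s' t' → r U (s + s') (t + t'))
    (hsmul : ∀ U (c : holFun U) s t, r U s t → r U (c • s) (c • t))
    (hres : ∀ U V (h : V ≤ U) s t, r U s t → r V (𝓕.res h s) (𝓖.res h t))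
    (hr : ∀ U s, ∃ t, r U s t) (hr' : ∀ U t, ∃ s, r U s t)
    (hu : ∀ U s t t', r U s t → r U s t' → t = t')
    (hu' : ∀ U s s' t, r U s t → r U s' t → s = s') : Nonempty (SheafIso 𝓕 𝓖) := by
  choose f hf using hr
  choose g hg using hr'
  exact ⟨{
    equiv := fun U =>
      { toFun := f U
        invFun := g U
        map_add' := fun s s' => hu U _ _ _ (hf U _) (hadd U _ _ _ _ (hf U s) (hf U s'))
        map_smul' := fun c s => hu U _ _ _ (hf U _) (hsmul U c _ _ (hf U s))
        left_inv := fun s => hu' U _ _ _ (hg U _) (hf U s)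
        right_inv := fun t => hu U _ _ _ (hf U _) (hg U t) }
    naturality := fun {U V} h s => hu V _ _ _ (hf V _) (hres U V h _ _ (hf U s)) }⟩

end SheafIsomorphisms

/-! ### Uniqueness of the type -/

section Uniqueness

variable {n : ℕ}

/-- The restriction to `U` of a section of `𝒪(a₁) ⊕ ⋯ ⊕ 𝒪(aₙ)`. -/
def sumOSection {a : Fin n → ℤ} (U : Opens RiemannSphere) (s : RiemannSphere → Fin n → ℂ)
    (hs : ∀ p ∈ U, ∀ i, HolTwistAt (a i) (fun q => s q i) p) : (sumO a).sections U :=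
  ⟨fun p => s p, fun p hp i => (hs p hp i).congr <| by
    filter_upwards [extendZero_coe_eventually (W := fun _ => Fin n → ℂ) s hp] with q hq
    rw [hq]⟩

theorem extendZero_sumOSection {a : Fin n → ℤ} {U : Opens RiemannSphere}
    {s : RiemannSphere → Fin n → ℂ}
    {hs : ∀ p ∈ U, ∀ i, HolTwistAt (a i) (fun q => s q i) p} {p : RiemannSphere} (hp : p ∈ U) :
    extendZero (W := fun _ => Fin n → ℂ) U (sumOSection U s hs).1 p = s p :=
  extendZero_of_mem (W := fun _ => Fin n → ℂ) _ hp

/-- Dividing by $z^k$ with $k>0$ shows that `f` tends to $0$ at infinity, and Liouville's theorem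
applies. -/
theorem eq_zero_of_tendsto_zpow_mul {f : ℂ → ℂ} (hf : Differentiable ℂ f) {k : ℤ} (hk : 0 < k)
    {c : ℂ} (h : Filter.Tendsto (fun z => z ^ k * f z) (Filter.cocompact ℂ) (𝓝 c)) (z : ℂ) :
    f z = 0 := by
  refine hf.apply_eq_of_tendsto_cocompact z ?_
  have h1 : Filter.Tendsto (fun z : ℂ => z⁻¹ ^ k.toNat) (Filter.cocompact ℂ) (𝓝 0) := by
    have h2 : Filter.Tendsto (fun z : ℂ => z⁻¹) (Filter.cocompact ℂ) (𝓝 0) := by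
      rw [← Metric.cobounded_eq_cocompact]
      exact Filter.tendsto_inv₀_cobounded
    have h3 := h2.pow k.toNat
    rwa [zero_pow (by omega)] at h3
  have h4 := h1.mul h
  rw [zero_mul] at h4
  refine h4.congr' ?_
  have h5 : ∀ᶠ z : ℂ in Filter.cocompact ℂ, z ≠ 0 := by
    rw [← Metric.cobounded_eq_cocompact]
    exact Bornology.eventually_ne_cobounded 0
  filter_upwards [h5] with z hz
  have h6 : z ^ k = z ^ k.toNat := by
    rw [← zpow_natCast, Int.toNat_of_nonneg hk.le]
  rw [h6, inv_pow, ← mul_assoc, inv_mul_cancel₀ (pow_ne_zero _ hz), one_mul]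

theorem holTwistAt_single {a : Fin n → ℤ} {j : Fin n} {f : RiemannSphere → ℂ} {p : RiemannSphere}
    (h : HolTwistAt (a j) f p) (i : Fin n) :
    HolTwistAt (a i) (fun q => (Pi.single j (f q) : Fin n → ℂ) i) p := by
  by_cases hij : i = j
  · subst hij
    simpa using h
  · simp only [Pi.single_eq_of_ne hij]
    exact HolTwistAt.zero (a i) p

/-- Let `A` be the matrix of the isomorphism in the standard frames over $\mathbb C$. Its entries
are entire, and comparison with the frames at infinity shows that $z^{a_j-b_i}A_{ij}$ has a limit
there, so $A_{ij}=0$ when $b_i<a_j$. As `A` is invertible at $0$, some term of the Leibniz expansion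
of its determinant is nonzero; that term gives the permutation. -/
theorem SheafIso.exists_perm_le {a b : Fin n → ℤ} (φ : SheafIso (sumO a) (sumO b)) :
    ∃ σ : Equiv.Perm (Fin n), ∀ j, a j ≤ b (σ j) := by
  let V₀ : Opens RiemannSphere := ⟨{OnePoint.infty}ᶜ, isOpen_compl_singleton⟩
  let V₁ : Opens RiemannSphere := ⟨{((0 : ℂ) : RiemannSphere)}ᶜ, isOpen_compl_singleton⟩
  have hcoe : ∀ z : ℂ, (z : RiemannSphere) ∈ V₀ := fun z => OnePoint.coe_ne_infty z
  have hconst : ∀ (c : Fin n → ℤ) (j : Fin n), ∀ p ∈ V₀, ∀ i,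
      HolTwistAt (c i) (fun _ => (Pi.single j (1 : ℂ) : Fin n → ℂ) i) p := fun c j p hp i =>
    ⟨fun h => absurd h hp, fun _ => holAt_const _ p⟩
  let S : ∀ j, (sumO a).sections V₀ := fun j => sumOSection V₀ _ (hconst a j)
  let T : ∀ j, (sumO b).sections V₀ := fun j => sumOSection V₀ _ (hconst b j)
  let S' : ∀ j, (sumO a).sections V₁ := fun j =>
    sumOSection V₁ (fun q => Pi.single j (vanishingSection ((0 : ℂ) : RiemannSphere) q ^ a j))
      fun p hp => holTwistAt_single (holTwistAt_vanishingSection_zpow hp (a j))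
  let A : RiemannSphere → Matrix (Fin n) (Fin n) ℂ := fun p =>
    Matrix.of fun i j => extendZero (W := fun _ => Fin n → ℂ) V₀ (φ.equiv V₀ (S j)).1 p i
  let B : RiemannSphere → Matrix (Fin n) (Fin n) ℂ := fun p =>
    Matrix.of fun i j => extendZero (W := fun _ => Fin n → ℂ) V₀ (φ.symm.equiv V₀ (T j)).1 p i
  have hAB : A ((0 : ℂ) : RiemannSphere) * B ((0 : ℂ) : RiemannSphere) = 1 := by
    have h1 : ∀ j, ∀ p ∈ V₀, extendZero (W := fun _ => Fin n → ℂ) V₀ (T j).1 p =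
        ∑ i, B p i j • extendZero (W := fun _ => Fin n → ℂ) V₀ (φ.equiv V₀ (S i)).1 p := by
      intro j
      have h2 := (φ.eq_sum_iff le_rfl le_rfl (φ.symm.equiv V₀ (T j)) S (fun i p => B p i j)
        fun i p hp => ((φ.symm.equiv V₀ (T j)).2 p hp i).2 hp).1 ?_
      · have h3 : φ.equiv V₀ (φ.symm.equiv V₀ (T j)) = T j := (φ.equiv V₀).apply_symm_apply _
        rwa [h3] at h2
      · intro p hp
        funext l
        simp only [S, extendZero_sumOSection hp, Finset.sum_apply, Pi.smul_apply, smul_eq_mul]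
        simp [Pi.single_apply, B]
    ext i j
    have h2 := congrFun (h1 j _ (hcoe 0)) i
    simp only [T, extendZero_sumOSection (hcoe 0), Finset.sum_apply, Pi.smul_apply,
      smul_eq_mul] at h2
    rw [Matrix.mul_apply, Matrix.one_apply]
    simp only [Pi.single_apply] at h2
    rw [h2]
    exact Finset.sum_congr rfl fun l _ => mul_comm _ _
  have hA0 : ∀ i j, b i < a j → ∀ z : ℂ, A z i j = 0 := by
    intro i j hij
    have hdiff : Differentiable ℂ fun z : ℂ => A z i j := fun z =>
      (holAt_coe_iff.1 (((φ.equiv V₀ (S j)).2 z (hcoe z) i).2 (hcoe z))).differentiableAt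
    have hrel : ∀ z : ℂ, z ≠ 0 →
        extendZero (W := fun _ => Fin n → ℂ) V₁ (φ.equiv V₁ (S' j)).1 z i = z ^ a j * A z i j := by
      intro z hz
      -- Over $\mathbb C\setminus\{0\}$ the frame at infinity is $z^{a_j}$ times the frame at $0$;
      -- this one-term relation is preserved by `φ`.
      have h1 := (φ.eq_sum_iff (ι := Unit) (U := V₀ ⊓ V₁) inf_le_right inf_le_left (S' j)
        (fun _ => S j) (fun _ q => vanishingSection ((0 : ℂ) : RiemannSphere) q ^ a j)
        fun _ p hp => (holTwistAt_vanishingSection_zpow hp.2 (a j)).2 hp.1).1 ?_ z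
        ⟨hcoe z, fun h => hz (OnePoint.coe_injective h)⟩
      · have h2 := congrFun h1 i
        simp only [Finset.univ_unique, Finset.sum_const, Finset.card_singleton, one_smul,
          Pi.smul_apply, smul_eq_mul] at h2
        rw [h2]
        simp [vanishingSection, A]
      · intro p hp
        funext l
        simp only [S, S', extendZero_sumOSection hp.1, extendZero_sumOSection hp.2]
        simp [Pi.single_apply]
    have hinf := (((φ.equiv V₁ (S' j)).2 OnePoint.infty (OnePoint.infty_ne_coe 0) i).1 rfl).continuousAt
    rw [OnePoint.continuousAt_infty', Filter.coclosedCompact_eq_cocompact] at hinf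
    refine eq_zero_of_tendsto_zpow_mul hdiff (sub_pos.2 hij) (hinf.congr' ?_)
    have h5 : ∀ᶠ z : ℂ in Filter.cocompact ℂ, z ≠ 0 := by
      rw [← Metric.cobounded_eq_cocompact]
      exact Bornology.eventually_ne_cobounded 0
    filter_upwards [h5] with z hz
    simp only [Function.comp_apply, inftyTwist, OnePoint.elim_some]
    rw [hrel z hz, ← mul_assoc, ← zpow_add₀ hz, neg_add_eq_sub]
  have hdet : (A ((0 : ℂ) : RiemannSphere)).det ≠ 0 := by
    intro h
    have := congrArg Matrix.det hAB
    rw [Matrix.det_mul, h, zero_mul, Matrix.det_one] at this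
    exact zero_ne_one this
  rw [Matrix.det_apply'] at hdet
  obtain ⟨σ, -, hσ⟩ := Finset.exists_ne_zero_of_sum_ne_zero hdet
  refine ⟨σ, fun j => not_lt.1 fun h => hσ ?_⟩
  exact mul_eq_zero_of_right _ (Finset.prod_eq_zero (Finset.mem_univ j) (hA0 _ _ h 0))

/-- If $b_i<a_i$, monotonicity forces `σ` to map the $i+1$ indices up to $i$ (counted from $0$) into
the $i$ indices before it. -/
theorem le_of_antitone_of_perm {a b : Fin n → ℤ} (ha : Antitone a) (hb : Antitone b)
    {σ : Equiv.Perm (Fin n)} (h : ∀ j, a j ≤ b (σ j)) : a ≤ b := by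
  intro i
  by_contra! hi
  have h1 : (Finset.Iic i).card ≤ (Finset.Iio i).card := by
    refine Finset.card_le_card_of_injOn σ (fun j hj => ?_) σ.injective.injOn
    rw [Finset.coe_Iio, Set.mem_Iio]
    by_contra! hle
    have h2 := ha (Finset.mem_Iic.1 hj)
    have h3 := hb hle
    exact absurd (h2.trans ((h j).trans h3)) (not_le.2 hi)
  rw [Fin.card_Iic, Fin.card_Iio] at h1
  omega

theorem SheafIso.type_eq {a b : Fin n → ℤ} (φ : SheafIso (sumO a) (sumO b)) (ha : Antitone a)
    (hb : Antitone b) : a = b := by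
  obtain ⟨σ, hσ⟩ := φ.exists_perm_le
  obtain ⟨τ, hτ⟩ := φ.symm.exists_perm_le
  exact le_antisymm (le_of_antitone_of_perm ha hb hσ) (le_of_antitone_of_perm hb ha hτ)

end Uniqueness

/-! ### Extension of sections across $x$ -/

section BundleSections

variable {n : ℕ} {E : RiemannSphere → Type*}
    [∀ p, AddCommGroup (E p)] [∀ p, Module ℂ (E p)] [∀ p, TopologicalSpace (E p)]
    [TopologicalSpace (TotalSpace (Fin n → ℂ) E)] [FiberBundle (Fin n → ℂ) E]
    [VectorBundle ℂ (Fin n → ℂ) E]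

theorem HolSecAt.eventually [ContMDiffVectorBundle ω (Fin n → ℂ) E 𝓘(ℂ)] {s : ∀ p, E p}
    {p : RiemannSphere} (hs : HolSecAt n s p) : ∀ᶠ q in 𝓝 p, HolSecAt n s q :=
  (contMDiffAt_iff_contMDiffAt_nhds (by simp)).1 hs

theorem HolSecAt.eq_of_eventually {s t : ∀ p, E p} {x : RiemannSphere} (hs : HolSecAt n s x)
    (ht : HolSecAt n t x) (h : ∀ᶠ q in 𝓝[≠] x, s q = t q) : s x = t x := by
  let e := trivializationAt (Fin n → ℂ) E x
  have h1 := ((Bundle.contMDiffAt_section x).1 hs).continuousAt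
  have h2 := ((Bundle.contMDiffAt_section x).1 ht).continuousAt
  have h3 : (e ⟨x, s x⟩).2 = (e ⟨x, t x⟩).2 := by
    have h4 := h1.mono_left (nhdsWithin_le_nhds (s := {x}ᶜ))
    have h5 := h2.mono_left (nhdsWithin_le_nhds (s := {x}ᶜ))
    refine tendsto_nhds_unique h4 (h5.congr' ?_)
    filter_upwards [h] with q hq
    rw [hq]
  have hx : x ∈ e.baseSet := FiberBundle.mem_baseSet_trivializationAt' x
  have h6 := (e.continuousLinearEquivAt ℂ x hx).injective (a₁ := s x) (a₂ := t x)
  exact h6 h3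

theorem mem_bundleSheaf_of_holSecAt {U : Opens RiemannSphere} {s : ∀ p, E p}
    (hs : ∀ p ∈ U, HolSecAt n s p) : (fun p : U => s p) ∈ (bundleSheaf n E).sections U :=
  fun p hp => (hs p hp).congr (extendZero_coe_eventually s hp)

/-- The germ condition supplies a holomorphic section near `x` that agrees with `s` off `x`; it
suffices to adopt its value at `x`. -/
theorem exists_bundleSheaf_section {U : Opens RiemannSphere} {x : RiemannSphere} {s : ∀ p, E p}
    (hs : ∀ p ∈ U, p ≠ x → HolSecAt n s p) (hx : x ∈ U → secGerm x s ∈ stalkLattice n E x) :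
    ∃ s' : (bundleSheaf n E).sections U, ∀ p (hp : p ∈ U), p ≠ x → s'.1 ⟨p, hp⟩ = s p := by
  classical
  by_cases hxU : x ∈ U
  · obtain ⟨σ, hσ, hsσ⟩ := hx hxU
    rw [secGerm_eq_iff] at hsσ
    refine ⟨⟨fun p => Function.update s x (σ x) p, mem_bundleSheaf_of_holSecAt fun p hp => ?_⟩,
      fun p hp hpx => Function.update_of_ne hpx _ _⟩
    by_cases hpx : p = x
    · subst hpx
      refine hσ.congr ?_
      rw [eventually_nhdsWithin_iff] at hsσ
      filter_upwards [hsσ] with q hq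
      by_cases hqx : q = p
      · subst hqx
        exact Function.update_self _ _ _
      · rw [Function.update_of_ne hqx, hq hqx]
    · refine (hs p hp hpx).congr ?_
      filter_upwards [isOpen_ne.mem_nhds hpx] with q hq
      exact Function.update_of_ne hq _ _
  · exact ⟨⟨fun p => s p, mem_bundleSheaf_of_holSecAt fun p hp =>
      hs p hp fun h => hxU (h ▸ hp)⟩, fun p hp _ => rfl⟩

theorem exists_sumO_section {U : Opens RiemannSphere} {x : RiemannSphere} {a : Fin n → ℤ}
    {s : RiemannSphere → Fin n → ℂ}
    (hs : ∀ p ∈ U, p ≠ x → ∀ i, HolTwistAt (a i) (fun q => s q i) p)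
    (hx : x ∈ U → ∀ i, twistGerm x (a i) (fun q => s q i) ∈ holGerm x) :
    ∃ t : (sumO a).sections U, ∀ p (hp : p ∈ U), p ≠ x → t.1 ⟨p, hp⟩ = s p := by
  have h : ∀ i, ∃ f : RiemannSphere → ℂ, (x ∈ U → HolTwistAt (a i) f x) ∧
      ∀ q, q ≠ x → f q = s q i := by
    intro i
    by_cases hxU : x ∈ U
    · obtain ⟨f, hf, hfs⟩ := exists_holTwistAt_of_twistGerm_mem (hx hxU i)
      exact ⟨f, fun _ => hf, hfs⟩
    · exact ⟨fun q => s q i, fun h => absurd h hxU, fun _ _ => rfl⟩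
  choose f hf hfs using h
  refine ⟨sumOSection U (fun q i => f i q) fun p hp i => ?_,
    fun p hp hpx => funext fun i => hfs i p hpx⟩
  by_cases hpx : p = x
  · subst hpx
    exact hf i hp
  · refine (hs p hp hpx i).congr ?_
    filter_upwards [isOpen_ne.mem_nhds hpx] with q hq
    exact hfs i q hq

end BundleSections

/-! ### Linear combinations of germs of sections -/

section SectionGerms

variable {W : RiemannSphere → Type*} [∀ p, AddCommGroup (W p)] [∀ p, Module ℂ (W p)]

theorem secGerm_sum {ι : Type*} (s : Finset ι) (x : RiemannSphere) (σ : ι → ∀ p, W p) :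
    secGerm x (fun p => ∑ i ∈ s, σ i p) = ∑ i ∈ s, secGerm x (σ i) := by
  have h := map_sum (eventuallyZero W x).mkQ σ s
  rw [← Finset.sum_fn]
  exact h

theorem sum_smul_secGerm {ι : Type*} (s : Finset ι) (x : RiemannSphere)
    (c : ι → RiemannSphere → ℂ) (σ : ι → ∀ p, W p) :
    ∑ i ∈ s, (c i : FunGerm x) • secGerm x (σ i) = secGerm x fun p => ∑ i ∈ s, c i p • σ i p := by
  rw [secGerm_sum]
  rfl

theorem mem_span_holGerm_iff {n : ℕ} {x : RiemannSphere} {v : Fin n → SecGerm W x}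
    {g : SecGerm W x} : g ∈ Submodule.span (holGerm x) (Set.range v) ↔
      ∃ f : Fin n → RiemannSphere → ℂ, (∀ i, HolAt (f i) x) ∧
        g = ∑ i, (f i : FunGerm x) • v i := by
  rw [Submodule.mem_span_range_iff_exists_fun]
  constructor
  · rintro ⟨c, rfl⟩
    choose f hf hcf using fun i => (c i).2
    refine ⟨f, hf, Finset.sum_congr rfl fun i _ => ?_⟩
    rw [← hcf i]
    rfl
  · rintro ⟨f, hf, rfl⟩
    exact ⟨fun i => ⟨f i, f i, hf i, rfl⟩, rfl⟩

theorem coordPow_add (x : RiemannSphere) (k l : ℤ) :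
    coordPow x (k + l) = coordPow x k * coordPow x l := by
  simp only [← coe_coordUnit_zpow, zpow_add, Units.val_mul]

theorem coordPow_zero (x : RiemannSphere) : coordPow x 0 = 1 := by
  rw [← coe_coordUnit_zpow, zpow_zero, Units.val_one]

end SectionGerms

/-! ### The stalk of $\mathcal E$ in coordinates given by a trivialisation of $\mathcal E^M$ -/

section LatticeCriterion

variable {n : ℕ} {E : RiemannSphere → Type*}
    [∀ p, AddCommGroup (E p)] [∀ p, Module ℂ (E p)] [∀ p, TopologicalSpace (E p)]
    [TopologicalSpace (TotalSpace (Fin n → ℂ) E)] [FiberBundle (Fin n → ℂ) E]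
    [VectorBundle ℂ (Fin n → ℂ) E]
    {x : RiemannSphere} {M : Submodule (holGerm x) (SecGerm E x)} {m : ℤ} {k : Fin n → ℤ}

/-- The elements of an adapted basis of `M` are germs of sections over a common neighbourhood. -/
theorem exists_local_frame [ContMDiffVectorBundle ω (Fin n → ℂ) E 𝓘(ℂ)] {e : Fin n → SecGerm E x}
    (heM : ∀ l, e l ∈ M) (he : ∀ l, coordPow x (k l) • e l ∈ stalkLattice n E x) :
    ∃ (U : Opens RiemannSphere) (S : Fin n → (modifiedSheaf n M).sections U), x ∈ U ∧
      ∀ l, secGerm x (extendZero U (S l).1) = e l := by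
  classical
  choose σ hσ hσe using he
  -- A representative of `e l`, obtained by dividing by $w^{k_l}$ a holomorphic section that
  -- represents $w^{k_l}e_l$. The value $0$ at `x` is the convention of `modifiedSheaf`.
  let s : Fin n → ∀ p, E p := fun l p => if p = x then 0 else localCoord x p ^ (-k l) • σ l p
  have hs : ∀ l, secGerm x (s l) = e l := by
    intro l
    have h1 : secGerm x (s l) = coordPow x (-k l) • secGerm x (σ l) := by
      refine secGerm_eq_iff.2 ?_
      filter_upwards [self_mem_nhdsWithin] with p hp
      exact if_neg hp
    rw [h1, ← hσe, smul_smul, ← coordPow_add, neg_add_cancel, coordPow_zero, one_smul]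
  have hhol : ∀ᶠ p in 𝓝[≠] x, ∀ l, HolSecAt n (s l) p := by
    refine Filter.eventually_all.2 fun l => ?_
    filter_upwards [eventually_holAt_localCoord_zpow x (-k l), self_mem_nhdsWithin,
      (hσ l).eventually.filter_mono nhdsWithin_le_nhds] with p h1 h2 h3
    have h4 : HolSecAt n (fun q => localCoord x q ^ (-k l) • σ l q) p :=
      ContMDiffAt.smul_section h1 h3
    refine h4.congr ?_
    filter_upwards [isOpen_ne.mem_nhds h2] with q hq
    exact if_neg hq
  obtain ⟨O, hO, hxO, hOs⟩ := mem_nhdsWithin.1 hhol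
  refine ⟨⟨O, hO⟩, fun l => ⟨fun p => s l p, fun p hp hpx => ?_, fun _ => ⟨?_, ?_⟩⟩, hxO,
    fun l => ?_⟩
  · exact (hOs ⟨hp, hpx⟩ l).congr (extendZero_coe_eventually (s l) hp)
  · rw [secGerm_eq_iff.2 ((extendZero_coe_eventually (s l) hxO).filter_mono nhdsWithin_le_nhds), hs]
    exact heM l
  · rw [extendZero_of_mem _ hxO]
    exact if_pos rfl
  · rw [← hs l]
    exact secGerm_eq_iff.2 ((extendZero_coe_eventually (s l) hxO).filter_mono nhdsWithin_le_nhds)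

/-- The components, near `x`, of the image of a section under a trivialisation. -/
def trivGerm (φ : SheafIso (modifiedSheaf n M) (sumO fun _ : Fin n => m)) {U : Opens RiemannSphere}
    (s : (modifiedSheaf n M).sections U) (j : Fin n) : FunGerm x :=
  twistGerm x m fun q => extendZero (W := fun _ => Fin n → ℂ) U (φ.equiv U s).1 q j

variable (φ : SheafIso (modifiedSheaf n M) (sumO fun _ : Fin n => m)) {U V : Opens RiemannSphere}
  (S : Fin n → (modifiedSheaf n M).sections U)

/-- The matrix, near `x`, of a family of sections under a trivialisation. -/
def frameMatrix : Matrix (Fin n) (Fin n) (FunGerm x) := Matrix.of fun j l => trivGerm φ (S l) j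

/-- An isomorphism of sheaves comes with no map on germs of meromorphic sections. This replaces it:
relations with coefficients holomorphic off `x` become matrix identities between germs. -/
theorem secGerm_eq_sum_iff (hU : x ∈ U) (hV : (V : Set RiemannSphere) ∈ 𝓝[≠] x)
    (s : (modifiedSheaf n M).sections V) (c : Fin n → RiemannSphere → ℂ)
    (hc : ∀ l, ∀ᶠ p in 𝓝[≠] x, HolAt (c l) p) :
    secGerm x (extendZero V s.1) = ∑ l, (c l : FunGerm x) • secGerm x (extendZero U (S l).1) ↔
      trivGerm φ s = (frameMatrix φ S).mulVec fun l => (c l : FunGerm x) := by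
  rw [sum_smul_secGerm, secGerm_eq_iff,
    φ.eventually_eq_sum_iff hV (mem_nhdsWithin_of_mem_nhds (U.2.mem_nhds hU)) s S c hc, funext_iff]
  have h1 : ∀ j, (frameMatrix φ S).mulVec (fun l => (c l : FunGerm x)) j =
      twistGerm x m fun q => ∑ l, c l q *
        extendZero (W := fun _ => Fin n → ℂ) U (φ.equiv U (S l)).1 q j := by
    intro j
    rw [twistGerm_sum, Matrix.mulVec, dotProduct]
    refine Finset.sum_congr rfl fun l _ => ?_
    rw [twistGerm_mul_left, mul_comm]
    rfl
  have h2 : ∀ j, trivGerm φ s j = (frameMatrix φ S).mulVec (fun l => (c l : FunGerm x)) j ↔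
      ∀ᶠ q in 𝓝[≠] x, extendZero (W := fun _ => Fin n → ℂ) V (φ.equiv V s).1 q j =
        ∑ l, c l q * extendZero (W := fun _ => Fin n → ℂ) U (φ.equiv U (S l)).1 q j := by
    intro j
    rw [h1, trivGerm, twistGerm_eq_iff]
  simp only [h2]
  rw [← Filter.eventually_all]
  refine Filter.eventually_congr (Filter.Eventually.of_forall fun q => ?_)
  rw [funext_iff]
  refine forall_congr' fun j => ?_
  rw [Finset.sum_apply]
  rfl

theorem secGerm_mem_stalkLattice_iff (hU : x ∈ U) (hV : (V : Set RiemannSphere) ∈ 𝓝[≠] x)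
    (hN : Submodule.span (holGerm x) (Set.range fun l =>
      coordPow x (k l) • secGerm x (extendZero U (S l).1)) = stalkLattice n E x)
    (s : (modifiedSheaf n M).sections V) :
    secGerm x (extendZero V s.1) ∈ stalkLattice n E x ↔
      ∃ r : Fin n → FunGerm x, (∀ i, r i ∈ holGerm x) ∧
        trivGerm φ s = (frameMatrix φ S * diagPow (coordUnit x) k).mulVec r := by
  have key : ∀ f : Fin n → RiemannSphere → ℂ, (∀ i, HolAt (f i) x) →
      (secGerm x (extendZero V s.1) = ∑ l, (f l : FunGerm x) •
        coordPow x (k l) • secGerm x (extendZero U (S l).1) ↔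
      trivGerm φ s = (frameMatrix φ S * diagPow (coordUnit x) k).mulVec
        fun l => (f l : FunGerm x)) := by
    intro f hf
    -- The factor $w^{k_l}$ is moved into the coefficient, which may then have a pole at `x` but
    -- stays holomorphic nearby off `x`.
    have h1 := secGerm_eq_sum_iff φ S hU hV s (fun l q => f l q * localCoord x q ^ k l) fun l => by
      filter_upwards [eventually_holAt_localCoord_zpow x (k l),
        (hf l).eventually.filter_mono nhdsWithin_le_nhds] with p h1 h2
      exact h2.mul h1
    have h2 : ∀ l, ((fun q => f l q * localCoord x q ^ k l : RiemannSphere → ℂ) : FunGerm x) =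
        (f l : FunGerm x) * coordPow x (k l) := fun l => rfl
    simp only [h2, mul_smul] at h1
    rw [h1, ← Matrix.mulVec_mulVec]
    have h3 : (diagPow (coordUnit x) k).mulVec (fun l => (f l : FunGerm x)) =
        fun l => (f l : FunGerm x) * coordPow x (k l) := by
      funext l
      rw [diagPow, Matrix.mulVec_diagonal, coe_coordUnit_zpow, mul_comm]
    rw [h3]
  rw [← hN, mem_span_holGerm_iff]
  constructor
  · rintro ⟨f, hf, h⟩
    exact ⟨fun l => (f l : FunGerm x), fun l => ⟨f l, hf l, rfl⟩, (key f hf).1 h⟩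
  · rintro ⟨r, hr, h⟩
    choose f hf hrf using hr
    obtain rfl : r = fun l => (f l : FunGerm x) := funext hrf
    exact ⟨f, hf, (key f hf).2 h⟩

/-- The standard frame of $\mathcal O(m)^n$ near `x` comes from sections of $\mathcal E^M$, whose
germs at `x` lie in `M` and so are combinations of the `S l` with coefficients in $\mathcal O_x$.
These coefficients give an integral right inverse of the frame matrix. -/
theorem isInvertibleOver_frameMatrix (hU : x ∈ U)
    (hM : Submodule.span (holGerm x) (Set.range fun l => secGerm x (extendZero U (S l).1)) = M) :
    IsInvertibleOver (holGerm x) (frameMatrix φ S) := by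
  obtain ⟨y, hy⟩ : ∃ y : RiemannSphere, y ≠ x := exists_ne x
  let V : Opens RiemannSphere := ⟨{y}ᶜ, isOpen_compl_singleton⟩
  have hxV : x ∈ V := hy.symm
  have hVx : (V : Set RiemannSphere) ∈ 𝓝[≠] x := mem_nhdsWithin_of_mem_nhds (V.2.mem_nhds hxV)
  -- The $m$-th power of a section of $\mathcal O(1)$ vanishing only at $y\ne x$ trivialises
  -- $\mathcal O(m)$ off $y$; its local expression at `x` is the unit `u` below.
  let v : Fin n → (sumO fun _ : Fin n => m).sections V := fun j =>
    sumOSection V (fun q => Pi.single j (vanishingSection y q ^ m)) fun p hp =>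
      holTwistAt_single (a := fun _ => m) (holTwistAt_vanishingSection_zpow hp m)
  let s : Fin n → (modifiedSheaf n M).sections V := fun j => φ.symm.equiv V (v j)
  have hs : ∀ j, φ.equiv V (s j) = v j := fun j => (φ.equiv V).apply_symm_apply _
  have hsM : ∀ j, secGerm x (extendZero V (s j).1) ∈ Submodule.span (holGerm x)
      (Set.range fun l => secGerm x (extendZero U (S l).1)) := by
    intro j
    rw [hM]
    exact ((s j).2.2 hxV).1
  choose f hf hsf using fun j => mem_span_holGerm_iff.1 (hsM j)
  have hrel : ∀ j, trivGerm φ (s j) = (frameMatrix φ S).mulVec fun l => (f j l : FunGerm x) :=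
    fun j => (secGerm_eq_sum_iff φ S hU hVx (s j) (f j) fun l =>
      (hf j l).eventually.filter_mono nhdsWithin_le_nhds).1 (hsf j)
  let u : RiemannSphere → ℂ := fun q => localTwist x 1 (vanishingSection y) q ^ m
  let u' : RiemannSphere → ℂ := fun q => localTwist x 1 (vanishingSection y) q ^ (-m)
  have hne : localTwist x 1 (vanishingSection y) x ≠ 0 :=
    localTwist_vanishingSection_ne_zero hy.symm
  have hu' : HolAt u' x := holAt_localTwist_vanishingSection.zpow hne (-m)
  have huu' : (u : FunGerm x) * (u' : FunGerm x) = 1 := by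
    refine Filter.Germ.coe_eq.2 ?_
    have h1 := (holAt_localTwist_vanishingSection (x := y) (p := x)).continuousAt.eventually_ne hne
    filter_upwards [h1.filter_mono nhdsWithin_le_nhds] with q hq
    change localTwist x 1 (vanishingSection y) q ^ m *
      localTwist x 1 (vanishingSection y) q ^ (-m) = 1
    rw [← zpow_add₀ hq, add_neg_cancel, zpow_zero]
  have hv : ∀ i j, trivGerm φ (s j) i = if i = j then (u : FunGerm x) else 0 := by
    intro i j
    have h1 : trivGerm φ (s j) i =
        twistGerm x m fun q => (Pi.single j (vanishingSection y q ^ m) : Fin n → ℂ) i := by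
      rw [trivGerm, twistGerm_eq_iff, hs]
      filter_upwards [hVx] with q hq
      rw [extendZero_sumOSection hq]
    rw [h1]
    split_ifs with h
    · subst h
      simp only [Pi.single_eq_same]
      have h2 := localTwist_zpow x 1 m (vanishingSection y)
      rw [mul_one] at h2
      rw [twistGerm, h2]
    · simp only [Pi.single_eq_of_ne h]
      have h2 := twistGerm_mul_left (x := x) (a := m) (f := fun _ => 0) (g := fun _ => 0)
      simp only [mul_zero] at h2
      rw [h2]
      exact zero_mul _
  refine isInvertibleOver_of_mul_eq_one (H' := Matrix.of fun l j => (f j l : FunGerm x) *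
    (u' : FunGerm x)) (fun i l => ?_) (fun l j => ?_) ?_
  · exact HolTwistAt.twistGerm_mem ((φ.equiv U (S l)).2 x hU i)
  · exact (holGerm x).mul_mem ⟨_, hf j l, rfl⟩ ⟨_, hu', rfl⟩
  · ext i j
    rw [Matrix.mul_apply, Matrix.one_apply]
    have h1 := congrFun (hrel j) i
    rw [hv, Matrix.mulVec, dotProduct] at h1
    have h2 : ∑ l, frameMatrix φ S i l * (Matrix.of fun l j => (f j l : FunGerm x) *
        (u' : FunGerm x)) l j = (∑ l, frameMatrix φ S i l * (f j l : FunGerm x)) *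
          (u' : FunGerm x) := by
      rw [Finset.sum_mul]
      refine Finset.sum_congr rfl fun l _ => ?_
      rw [Matrix.of_apply, mul_assoc]
    rw [h2, ← h1]
    split_ifs
    · exact huu'
    · exact zero_mul _

end LatticeCriterion

/-! ### Splitting of $\mathcal E$ -/

section Classification

/-- The open set `U ∖ {x}`. -/
def punctured (x : RiemannSphere) (U : Opens RiemannSphere) : Opens RiemannSphere :=
  U ⊓ ⟨{x}ᶜ, isOpen_compl_singleton⟩

theorem punctured_mono {x : RiemannSphere} {U V : Opens RiemannSphere} (h : V ≤ U) :
    punctured x V ≤ punctured x U := inf_le_inf_right _ h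

theorem punctured_mem_nhdsNE {x : RiemannSphere} {U : Opens RiemannSphere} (hx : x ∈ U) :
    (punctured x U : Set RiemannSphere) ∈ 𝓝[≠] x :=
  Filter.inter_mem (mem_nhdsWithin_of_mem_nhds (U.2.mem_nhds hx)) self_mem_nhdsWithin

variable {n : ℕ} {E : RiemannSphere → Type*}
    [∀ p, AddCommGroup (E p)] [∀ p, Module ℂ (E p)] [∀ p, TopologicalSpace (E p)]
    [TopologicalSpace (TotalSpace (Fin n → ℂ) E)] [FiberBundle (Fin n → ℂ) E]
    [VectorBundle ℂ (Fin n → ℂ) E]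
    {x : RiemannSphere} {M : Submodule (holGerm x) (SecGerm E x)} {m : ℤ}

/-- The restriction of a section of `E` to the complement of `x`, as a section of `E ^ M`. -/
def restrictOff (M : Submodule (holGerm x) (SecGerm E x)) {U : Opens RiemannSphere}
    (s : (bundleSheaf n E).sections U) : (modifiedSheaf n M).sections (punctured x U) :=
  ⟨restrictSec inf_le_left s.1,
    fun _ hp _ => (bundleSheaf n E).restrict_mem (inf_le_left : punctured x U ≤ U) s.2 _ hp,
    fun hx => absurd rfl hx.2⟩

theorem exists_restrictOff_eq {U : Opens RiemannSphere}
    (s : (modifiedSheaf n M).sections (punctured x U))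
    (hx : x ∈ U → secGerm x (extendZero (punctured x U) s.1) ∈ stalkLattice n E x) :
    ∃ s' : (bundleSheaf n E).sections U, restrictOff M s' = s := by
  obtain ⟨s', hs'⟩ := exists_bundleSheaf_section (U := U) (x := x)
    (s := extendZero (punctured x U) s.1)
    (fun p hp hpx => s.2.1 p ⟨hp, hpx⟩ hpx) hx
  refine ⟨s', Subtype.ext (funext fun p => ?_)⟩
  exact (hs' p p.2.1 p.2.2).trans (extendZero_of_mem _ p.2)

/-- Two holomorphic sections that agree off `x` agree at `x` by continuity. Sections of $\mathcal E$
can thus be handled through their restrictions off `x`, where $\mathcal E$ and $\mathcal E^M$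
coincide. -/
theorem restrictOff_injective {U : Opens RiemannSphere} :
    Function.Injective (restrictOff M : (bundleSheaf n E).sections U → _) := by
  intro s s' h
  have hoff : ∀ p (hp : p ∈ U), p ≠ x → s.1 ⟨p, hp⟩ = s'.1 ⟨p, hp⟩ := fun p hp hpx =>
    congrFun (congrArg Subtype.val h) ⟨p, hp, hpx⟩
  refine Subtype.ext (funext fun ⟨p, hp⟩ => ?_)
  by_cases hpx : p = x
  · subst hpx
    have h1 := (s.2 p hp).eq_of_eventually (s'.2 p hp) (by
      filter_upwards [punctured_mem_nhdsNE hp] with q hq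
      rw [extendZero_of_mem _ hq.1, extendZero_of_mem _ hq.1]
      exact hoff q hq.1 hq.2)
    rwa [extendZero_of_mem _ hp, extendZero_of_mem _ hp] at h1
  · exact hoff p hp hpx

theorem secGerm_restrictOff_mem {U : Opens RiemannSphere} (hx : x ∈ U)
    (s : (bundleSheaf n E).sections U) :
    secGerm x (extendZero (punctured x U) (restrictOff M s).1) ∈ stalkLattice n E x := by
  refine ⟨extendZero U s.1, s.2 x hx, secGerm_eq_iff.2 ?_⟩
  filter_upwards [punctured_mem_nhdsNE hx] with q hq
  rw [extendZero_of_mem _ hq, extendZero_of_mem _ hq.1]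
  rfl

theorem sumO_section_ext {a : Fin n → ℤ} {U : Opens RiemannSphere} {t t' : (sumO a).sections U}
    (h : ∀ p (hp : p ∈ U), p ≠ x → t.1 ⟨p, hp⟩ = t'.1 ⟨p, hp⟩) : t = t' := by
  refine Subtype.ext (funext fun ⟨p, hp⟩ => ?_)
  by_cases hpx : p = x
  · subst hpx
    funext i
    have h1 := (t.2 p hp i).eq_of_eventually (t'.2 p hp i) (by
      filter_upwards [punctured_mem_nhdsNE hp] with q hq
      rw [extendZero_of_mem (W := fun _ => Fin n → ℂ) _ hq.1,
        extendZero_of_mem (W := fun _ => Fin n → ℂ) _ hq.1, h q hq.1 hq.2])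
    rwa [extendZero_of_mem (W := fun _ => Fin n → ℂ) _ hp,
      extendZero_of_mem (W := fun _ => Fin n → ℂ) _ hp] at h1
  · exact h p hp hpx

/-- A bundle is a sum of line bundles as soon as its stalk at `x` is diagonalised by a matrix with
poles only at `x`. -/
theorem nonempty_sheafIso_sumO (φ : SheafIso (modifiedSheaf n M) (sumO fun _ : Fin n => m))
    {P P' : Matrix (Fin n) (Fin n) (Polynomial ℂ)} (hP : P * P' = 1) {b : Fin n → ℤ}
    (h : ∀ (V : Opens RiemannSphere) (s : (modifiedSheaf n M).sections V),
      (V : Set RiemannSphere) ∈ 𝓝[≠] x →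
      (secGerm x (extendZero V s.1) ∈ stalkLattice n E x ↔
        ∀ i, (diagPow (coordUnit x) (-b) * evalInv (constGerm x) (coordUnit x) P').mulVec
          (trivGerm φ s) i ∈ holGerm x)) :
    Nonempty (SheafIso (bundleSheaf n E) (sumO fun i => m - b i)) := by
  -- The image of a section off `x`, in the trivialisation of `E ^ M`.
  let T : ∀ {U : Opens RiemannSphere}, (bundleSheaf n E).sections U → (p : RiemannSphere) →
      p ∈ punctured x U → Fin n → ℂ := fun {U} s p hp =>
    (φ.equiv (punctured x U) (restrictOff M s)).1 ⟨p, hp⟩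
  -- Two sections correspond when the matrix $w^{-b}P'(1/w)$ carries one to the other off `x`. The
  -- values at `x` need not be described, being determined by continuity.
  refine nonempty_sheafIso_of_correspondence
    (fun U s t => ∀ p (hp : p ∈ punctured x U),
      t.1 ⟨p, hp.1⟩ = (poleMatrix x P' b p).mulVec (T s p hp)) ?_ ?_ ?_ ?_ ?_ ?_ ?_
  · intro U s s' t t' h1 h2 p hp
    have h3 : T (s + s') p hp = T s p hp + T s' p hp :=
      congrFun (congrArg Subtype.val ((φ.equiv (punctured x U)).map_add
        (restrictOff M s) (restrictOff M s'))) ⟨p, hp⟩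
    rw [h3, Matrix.mulVec_add, ← h1 p hp, ← h2 p hp]
    rfl
  · intro U c s t h1 p hp
    have h3 : T (c • s) p hp = c.1 ⟨p, hp.1⟩ • T s p hp :=
      congrFun (congrArg Subtype.val ((φ.equiv (punctured x U)).map_smul
        (⟨fun q => c.1 ⟨q, q.2.1⟩, fun q hq => (c.2 q hq.1).congr
          (extendZero_restrictSec (W := fun _ => ℂ) inf_le_left c.1 hq)⟩ : holFun (punctured x U))
        (restrictOff M s))) ⟨p, hp⟩
    rw [h3, Matrix.mulVec_smul, ← h1 p hp]
    rfl
  · intro U V hVU s t h1 p hp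
    have h3 : T ((bundleSheaf n E).res hVU s) p hp = T s p (punctured_mono hVU hp) :=
      congrFun (congrArg Subtype.val (φ.naturality (punctured_mono hVU) (restrictOff M s))) ⟨p, hp⟩
    rw [h3]
    exact h1 p _
  · intro U s
    let t₀ := φ.equiv (punctured x U) (restrictOff M s)
    obtain ⟨t, ht⟩ := exists_sumO_section (U := U) (x := x) (a := fun i => m - b i)
      (s := fun q => (poleMatrix x P' b q).mulVec
        (extendZero (W := fun _ => Fin n → ℂ) (punctured x U) t₀.1 q))
      (fun p hp hpx i => holTwistAt_poleMatrix_mulVec hpx (t₀.2 p ⟨hp, hpx⟩) i)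
      -- The image extends across `x` because the germ of `s` lies in the stalk of $\mathcal E$,
      -- which `h` turns into integrality of the transformed components.
      (fun hx i => by
        rw [twistGerm_poleMatrix_mulVec]
        exact (h _ _ (punctured_mem_nhdsNE hx)).1 (secGerm_restrictOff_mem hx s) i)
    refine ⟨t, fun p hp => (ht p hp.1 hp.2).trans ?_⟩
    exact congrArg _ (extendZero_of_mem (W := fun _ => Fin n → ℂ) _ hp)
  · intro U t
    let t₀ : (sumO fun _ : Fin n => m).sections (punctured x U) :=
      sumOSection _ (fun q => (poleMatrixInv x P b q).mulVec
        (extendZero (W := fun _ => Fin n → ℂ) U t.1 q))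
        fun p hp i => holTwistAt_poleMatrixInv_mulVec hp.2 (t.2 p hp.1) i
    let s₀ := (φ.equiv (punctured x U)).symm t₀
    have hs₀ : φ.equiv (punctured x U) s₀ = t₀ := (φ.equiv (punctured x U)).apply_symm_apply _
    have hmul : ∀ p, p ≠ x → ∀ y : Fin n → ℂ,
        (poleMatrix x P' b p).mulVec ((poleMatrixInv x P b p).mulVec y) = y := by
      intro p hp y
      rw [Matrix.mulVec_mulVec, poleMatrix_mul_poleMatrixInv hP hp, Matrix.one_mulVec]
    -- Conversely, the transformed components of the candidate are those of `t`, which are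
    -- holomorphic at `x`; by `h` its germ lies in the stalk of $\mathcal E$.
    obtain ⟨s, hs⟩ := exists_restrictOff_eq s₀ fun hx => by
      refine (h _ _ (punctured_mem_nhdsNE hx)).2 fun i => ?_
      have h1 : twistGerm x (m - b i) (fun q => (poleMatrix x P' b q).mulVec
          (extendZero (W := fun _ => Fin n → ℂ) (punctured x U)
            (φ.equiv (punctured x U) s₀).1 q) i) =
          twistGerm x (m - b i) (fun q => extendZero (W := fun _ => Fin n → ℂ) U t.1 q i) := by
        rw [twistGerm_eq_iff]
        filter_upwards [punctured_mem_nhdsNE hx] with q hq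
        rw [hs₀, extendZero_sumOSection hq, hmul q hq.2]
      rw [twistGerm_poleMatrix_mulVec] at h1
      exact h1 ▸ (t.2 x hx i).twistGerm_mem
    refine ⟨s, fun p hp => ?_⟩
    have h2 : T s p hp = (poleMatrixInv x P b p).mulVec
        (extendZero (W := fun _ => Fin n → ℂ) U t.1 p) := by
      change (φ.equiv (punctured x U) (restrictOff M s)).1 ⟨p, hp⟩ = _
      rw [hs, hs₀]
      rfl
    rw [h2, hmul p hp.2]
    exact (extendZero_of_mem (W := fun _ => Fin n → ℂ) _ hp.1).symm
  · intro U s t t' h1 h2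
    exact sumO_section_ext fun p hp hpx => (h1 p ⟨hp, hpx⟩).trans (h2 p ⟨hp, hpx⟩).symm
  · intro U s s' t h1 h2
    refine restrictOff_injective (M := M) ((φ.equiv _).injective (Subtype.ext (funext fun p => ?_)))
    have h3 := (h1 p p.2).symm.trans (h2 p p.2)
    have h4 := congrArg (poleMatrixInv x P b p).mulVec h3
    simpa only [Matrix.mulVec_mulVec, poleMatrixInv_mul_poleMatrix hP p.2.2,
      Matrix.one_mulVec] using h4

end Classification

end

theorem mainTheorem9 {n : ℕ} (E : RiemannSphere → Type*)
    [∀ p, AddCommGroup (E p)] [∀ p, Module ℂ (E p)] [∀ p, TopologicalSpace (E p)]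
    [TopologicalSpace (TotalSpace (Fin n → ℂ) E)] [FiberBundle (Fin n → ℂ) E]
    [VectorBundle ℂ (Fin n → ℂ) E] [ContMDiffVectorBundle ω (Fin n → ℂ) E 𝓘(ℂ)]
    (x : RiemannSphere) (M : Submodule (holGerm x) (SecGerm E x)) (hM : IsLattice n E M)
    (m : ℤ) (htriv : Nonempty (SheafIso (modifiedSheaf n M) (sumO fun _ : Fin n => m)))
    (k : Fin n → ℤ) (hk : IsElementaryDivisors M (stalkLattice n E x) k) :
    ∃ a : Fin n → ℤ, HasType n E a ∧ (∀ b : Fin n → ℤ, HasType n E b → b = a) ∧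
      ∃ (w : ℕ → Equiv.Perm (Fin n)) (σ : Equiv.Perm (Fin n)), w 1 = 1 ∧
        ∀ i, a (σ i) = m - (⨅ j, k j) -
          ∑ j ∈ Finset.Icc 1 (splittingLength k), elementarySplitting k j ((w j).symm i) := by
  obtain ⟨φ⟩ := htriv
  obtain ⟨-, e, ⟨-, heM⟩, -, heN⟩ := hk
  obtain ⟨U, S, hU, hS⟩ := exists_local_frame (M := M) (e := e)
    (fun l => heM.le (Submodule.subset_span (Set.mem_range_self l)))
    (fun l => heN.le (Submodule.subset_span (Set.mem_range_self l)))
  obtain rfl : e = fun l => secGerm x (extendZero U (S l).1) := funext fun l => (hS l).symm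
  obtain ⟨P, P', b, ρ, hP, hb, hbk, hcrit⟩ := exists_lattice_criterion (constGerm x)
    (coordUnit_mem_holGerm x) (constGerm_mem_holGerm x) (germValue x) germValue_const
    (fun _ => exists_eq_coordUnit_mul) (isInvertibleOver_frameMatrix φ S hU heM) k
  obtain ⟨ψ⟩ := nonempty_sheafIso_sumO φ hP (b := b) fun V s hV =>
    (secGerm_mem_stalkLattice_iff φ S hU hV heN s).trans (hcrit _)
  -- The exponents `b` were sorted upwards, so the degrees decrease.
  have ha : Antitone fun i => m - b i := fun i j hij => sub_le_sub_left (hb hij) m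
  refine ⟨fun i => m - b i, ⟨ha, ⟨ψ⟩⟩, fun c ⟨hc, ⟨χ⟩⟩ => (χ.symm.trans ψ).type_eq hc ha,
    -- Reindexing by $\rho_1^{-1}$ makes the permutation of $T_1$ trivial; $\rho_1^{-1}$ itself
    -- becomes the overall permutation of the entries.
    fun l => ((ρ 1).symm.trans (ρ l)).symm, (ρ 1).symm, by simp; rfl, fun i => ?_⟩
  simp only [hbk, Equiv.symm_symm, Equiv.trans_apply]
  ring
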